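/- For $n\in\mathbb Z$ let $J_n$ be the Bessel function of order $n$, i.e. $J_n(z)=\sum_{r\ge 0}\frac{(-1)^r (z/2)^{n+2r}}{r!\,(n+r)!}$ for $n\ge 0$ and $J_{-n}=(-1)^nJ_n$. For $\nu\in\mathbb Z$ put $L_{0,\nu}(z)=-\frac{d}{dz}\bigl(J_\nu(z)^2\bigr)=-2J_\nu(z)J_\nu'(z)$ and $$\mathcal Z_{0,\nu}=\{\lambda\in\mathbb C\setminus\{0\}: L_{0,\nu}(\lambda)=0\},$$ the set of nonzero zeros of $J_\nu$ and of $J_\nu'$. For $\lambda\in\mathcal Z_{0,\nu}$ define the function $\varphi^{(0)}_{\nu,\lambda}$ almost everywhere on $\mathbb P^1(\mathbb C)=\mathbb C\cup\{\infty\}$, with $z=re^{i\theta}$, by $$\varphi^{(0)}_{\nu,\lambda}(z)=\begin{cases}\varepsilon\, J_\nu(\lambda r)e^{i\nu\theta}& r\le 1,\\ J_\nu(\lambda/r)e^{i\nu\theta}& r>1,\end{cases}\qquad \varepsilon=\begin{cases}+1&\text{if }J_\nu'(\lambda)=0,\\-1&\text{if }J_\nu(\lambda)=0.\end{cases}$$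 Let $\mathcal H^{(0)}$ be the completion of the space of complex-valued $C^\infty$ functions on $\mathbb P^1(\mathbb C)$ for the $L^2$ Hermitian product $(f,g)=\int_{\mathbb P^1} f\,\overline g\;\omega_\infty$, where $\omega_\infty=\frac{i}{2\pi}\frac{dz\wedge d\bar z}{\max(1,|z|^2)^2}$, realised as the closure of that space in $L^2(\mathbb P^1,\omega_\infty)$. **Theorem.** For all $\nu\in\mathbb Z$ and $\lambda\in\mathcal Z_{0,\nu}$ one has $-\lambda\in\mathcal Z_{0,\nu}$ and $\varphi^{(0)}_{\nu,-\lambda}=(-1)^\nu\varphi^{(0)}_{\nu,\lambda}$. The family $$\{1\}\cup\{\varphi^{(0)}_{\nu,\lambda}:\nu\in\mathbb Z,\ \lambda\in\mathcal Z_{0,\nu}\},$$ in which, for each $\nu$, exactly one element $\lambda$ is kept from each pair $\{\lambda,-\lambda\}\subset\mathcal Z_{0,\nu}$ (no matter which one), is a Hilbert basis of $\mathcal H^{(0)}$: its members are nonzero elements of $\mathcal H^{(0)}$, and after division by their norms they form an orthonormal basis of $\mathcal H^{(0)}$. -/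

import Mathlib

open MeasureTheory
open scoped ContDiff

noncomputable section

namespace CanonicalLaplacian

/-- The Bessel function of order `n : ℕ`, by its power series (which converges absolutely on `ℂ`). -/
def besselJNat (n : ℕ) (z : ℂ) : ℂ :=
  ∑' r : ℕ, (-1) ^ r * (z / 2) ^ (n + 2 * r) / ((r.factorial : ℂ) * ((n + r).factorial : ℂ))

/-- The Bessel function `J_n` of integral order, with `J_{-n} = (-1)^n J_n`. -/
def besselJ : ℤ → ℂ → ℂ
  | Int.ofNat n, z => besselJNat n z
  | Int.negSucc n, z => (-1) ^ (n + 1) * besselJNat (n + 1) z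

/-- The function `L_{m,n}(z) = - z^m (d/dz) (z^{-m} J_n(z) J_{n-m}(z))`, used for `z ≠ 0`. -/
def besselL (m : ℕ) (n : ℤ) (z : ℂ) : ℂ :=
  -z ^ m * deriv (fun w : ℂ => w ^ (-(m : ℤ)) * (besselJ n w * besselJ (n - m) w)) z

/-- The set `𝒵_{m,n}` of zeros of `L_{m,n}` in `ℂ \ {0}`. -/
def zeroSet (m : ℕ) (n : ℤ) : Set ℂ :=
  {z | z ≠ 0 ∧ besselL m n z = 0}

/-- The chart of the Riemann sphere at infinity: `w ↦ 1 / w`, with `0 ↦ ∞`. -/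
def chartInfty (w : ℂ) : OnePoint ℂ :=
  if w = 0 then OnePoint.infty else ((w⁻¹ : ℂ) : OnePoint ℂ)

/-- Smooth complex valued functions on `ℙ¹(ℂ) = ℂ ∪ {∞}`: smooth in both standard charts. -/
def IsSmoothOnSphere (f : OnePoint ℂ → ℂ) : Prop :=
  ContDiff ℝ ∞ (fun z : ℂ => f (z : OnePoint ℂ)) ∧ ContDiff ℝ ∞ (fun w : ℂ => f (chartInfty w))

/-- The measure of the canonical Kähler form
`ω_∞ = (i / 2π) dz ∧ dz̄ / max(1, |z|²)² = (1 / π) dx dy / max(1, |z|²)²`.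
The point at infinity is a null set, so that the measure is given on `ℂ`. -/
def omegaInfty : Measure ℂ :=
  (volume : Measure ℂ).withDensity
    (fun z => ENNReal.ofReal (1 / (Real.pi * (max 1 (‖z‖ ^ 2)) ^ 2)))

instance isFiniteMeasure_omegaInfty : IsFiniteMeasure omegaInfty := by
  refine isFiniteMeasure_withDensity (ne_of_lt ?_)
  have h := finite_integral_one_add_norm (E := ℂ) (μ := (volume : Measure ℂ)) (r := 4)
    (by rw [Complex.finrank_real_complex]; norm_num)
  have h' : (∫⁻ z : ℂ, ENNReal.ofReal 16 * ENNReal.ofReal ((1 + ‖z‖) ^ (-(4 : ℝ)))) < ⊤ := by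
    rw [lintegral_const_mul' _ _ ENNReal.ofReal_ne_top]
    exact ENNReal.mul_lt_top ENNReal.ofReal_lt_top h
  refine lt_of_le_of_lt (lintegral_mono fun z => ?_) h'
  rw [← ENNReal.ofReal_mul (by norm_num)]
  apply ENNReal.ofReal_le_ofReal
  have hz := norm_nonneg z
  have hp : (0 : ℝ) < 1 + ‖z‖ := by linarith
  rw [Real.rpow_neg hp.le, ← div_eq_mul_inv]
  have e4 : (1 + ‖z‖) ^ (4 : ℝ) = (1 + ‖z‖) ^ (4 : ℕ) := by
    rw [← Real.rpow_natCast]; norm_num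
  rw [e4, div_le_div_iff₀ (by positivity) (by positivity)]
  have hpi : (1 : ℝ) ≤ Real.pi := by linarith [Real.pi_gt_three]
  set M := max 1 (‖z‖ ^ 2) with hM
  have h1 : (1 : ℝ) ≤ M := le_max_left _ _
  have h2 : ‖z‖ ^ 2 ≤ M := le_max_right _ _
  have h3 : (1 + ‖z‖) ^ 2 ≤ 4 * M := by nlinarith [sq_nonneg (‖z‖ - 1)]
  have h4 : (1 + ‖z‖) ^ 4 ≤ 16 * M ^ 2 := by nlinarith [sq_nonneg (1 + ‖z‖)]
  have h5 : M ^ 2 ≤ Real.pi * M ^ 2 := by nlinarith [sq_nonneg M]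
  linarith

/-- Smooth functions on the Riemann sphere are square integrable, so that each of them has a class
in `L²(ω_∞)`. -/
theorem IsSmoothOnSphere.memLp {f : OnePoint ℂ → ℂ} (hf : IsSmoothOnSphere f) :
    MemLp (fun z : ℂ => f (z : OnePoint ℂ)) 2 omegaInfty := by
  obtain ⟨C, hC⟩ := (isCompact_closedBall (0 : ℂ) 1).exists_bound_of_continuousOn
    hf.1.continuous.continuousOn
  obtain ⟨D, hD⟩ := (isCompact_closedBall (0 : ℂ) 1).exists_bound_of_continuousOn
    hf.2.continuous.continuousOn
  refine MemLp.of_bound hf.1.continuous.aestronglyMeasurable (max C D) (ae_of_all _ fun z => ?_)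
  by_cases hz : ‖z‖ ≤ 1
  · exact (hC z (by simpa using hz)).trans (le_max_left _ _)
  · have hz' : z ≠ 0 := by rintro rfl; simp at hz
    have := hD z⁻¹ (by
      simp only [mem_closedBall_zero_iff, norm_inv]
      exact inv_le_one_of_one_le₀ (not_le.mp hz).le)
    simp only [chartInfty, inv_eq_zero, hz', if_false, inv_inv] at this
    exact this.trans (le_max_right _ _)

/-- The classes in `L²(ω_∞)` of the smooth functions on the Riemann sphere. -/
def smoothClasses : Submodule ℂ (Lp ℂ 2 omegaInfty) where
  carrier := {g | ∃ f : OnePoint ℂ → ℂ, IsSmoothOnSphere f ∧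
    (g : ℂ → ℂ) =ᵐ[omegaInfty] fun z : ℂ => f (z : OnePoint ℂ)}
  zero_mem' := ⟨fun _ => 0, ⟨contDiff_const, contDiff_const⟩, Lp.coeFn_zero _ _ _⟩
  add_mem' := by
    rintro a b ⟨f, hf, hfa⟩ ⟨g, hg, hgb⟩
    refine ⟨fun x => f x + g x, ⟨hf.1.add hg.1, hf.2.add hg.2⟩, ?_⟩
    filter_upwards [Lp.coeFn_add a b, hfa, hgb] with z h1 h2 h3
    rw [h1, Pi.add_apply, h2, h3]
  smul_mem' := by
    rintro c a ⟨f, hf, hfa⟩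
    refine ⟨fun x => c * f x, ⟨contDiff_const.mul hf.1, contDiff_const.mul hf.2⟩, ?_⟩
    filter_upwards [Lp.coeFn_smul c a, hfa] with z h1 h2
    rw [h1, Pi.smul_apply, h2, smul_eq_mul]

/-- The Hilbert space `ℋ^{(0)}`: the completion of the space of smooth functions on the Riemann
sphere for the `L²` product of `ω_∞`, realised as its closure in `L²(ω_∞)`. -/
def H0 : Submodule ℂ (Lp ℂ 2 omegaInfty) :=
  smoothClasses.topologicalClosure

open scoped Classical in
/-- The function `φ^{(0)}_{ν,λ}`, with `z = r e^{iθ}`, for `λ` in `zeroSet 0 ν`: the sign on the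
unit disc is `+` when `J_ν'(λ) = 0` and `-` otherwise, that is, when `J_ν(λ) = 0`. -/
def phi (ν : ℤ) (l : ℂ) (z : ℂ) : ℂ :=
  (if ‖z‖ ≤ 1 then
    (if deriv (besselJ ν) l = 0 then besselJ ν (l * ‖z‖) else -besselJ ν (l * ‖z‖))
  else besselJ ν (l / ‖z‖)) * Complex.exp (Complex.I * ν * Complex.arg z)

/-- The family consisting of the constant function `1` (index `none`) and of the functions
`φ^{(0)}_{ν,λ}` with `ν ∈ ℤ` and `λ ∈ S ν`. -/
def family (S : ℤ → Set ℂ) : Option (Σ ν : ℤ, S ν) → ℂ → ℂ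
  | none => fun _ => 1
  | some p => phi p.1 p.2

end CanonicalLaplacian

end

/-! Put w = λ² and n = |ν|. Up to a nonzero constant, φ is `psi ν s w`: the product of e^{iνθ}, the
radial function R_w(ρ) = ρⁿ E_n(wρ²), where ρ is the distance to 0 after reflection into the disc,
and a sign giving the parity s under that reflection. The condition on λ becomes E_n(w) = 0 (odd,
Dirichlet) or B_n(w) = 0 (even, Neumann); the constant 1 is the remaining case w = 0 of B_0.
Orthogonality in ν and s comes from the angle and the reflection. In w it is Lagrange's identity
`integral_radial_mul_radial`, whose boundary term vanishes; the same identity shows that all zeros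
are real and simple.

For completeness, let f be orthogonal to the family. For fixed ν and s, F(w) = ∫ psi·f is entire
with coefficients m_k c_k, where c_k are the Bessel coefficients and the moments m_k of f tend to 0.
It vanishes at the simple zeros of D, which is E_n or B_n, so F = K·D with K entire. Cauchy-Schwarz
bounds |F| by the norm of R_w, and `exists_sqrt_radialNormSq_mul_im_le` bounds that norm by a
multiple of |w||D(w)|/|Im w| for |w| ≥ 1. Hence |K(w)||Im w| = O(|w|), which forces K to be constant
(`eq_const_of_norm_mul_im_le`). Comparing coefficients, m_k = K d_k with |d_k| ≥ 1 for k ≥ 1, so m_k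
→ 0 gives K = 0. All moments vanish, the two parities separate the inside of the disc from the
outside, and Stone-Weierstrass gives f = 0. No asymptotics of Bessel functions are needed. -/

namespace CanonicalLaplacian

/-! ### Entire power series -/

/-- Coefficient sequences of power series with infinite radius of convergence. -/
def EntireCoeff (b : ℕ → ℂ) : Prop :=
  ∀ R : ℝ, 0 ≤ R → Summable fun k => ‖b k‖ * R ^ k

/-- The sum of the power series with coefficients `b`. -/
noncomputable def powerSum (b : ℕ → ℂ) (w : ℂ) : ℂ :=
  ∑' k, b k * w ^ k

/-- The coefficients of `n p + 2 w p'`, where `p` has coefficients `b`. -/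
def eulerCoeff (n : ℕ) (b : ℕ → ℂ) (k : ℕ) : ℂ :=
  ((n : ℂ) + 2 * k) * b k

theorem EntireCoeff.summable {b : ℕ → ℂ} (hb : EntireCoeff b) (w : ℂ) :
    Summable fun k => b k * w ^ k :=
  Summable.of_norm (by simpa using hb ‖w‖ (norm_nonneg w))

theorem EntireCoeff.mono {b c : ℕ → ℂ} (hb : EntireCoeff b) (C : ℝ)
    (h : ∀ k, ‖c k‖ ≤ C * ‖b k‖) : EntireCoeff c := fun R hR => by
  refine Summable.of_nonneg_of_le (fun k => by positivity) (fun k => ?_) ((hb R hR).mul_left C)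
  rw [← mul_assoc]
  exact mul_le_mul_of_nonneg_right (h k) (by positivity)

theorem EntireCoeff.eulerCoeff {b : ℕ → ℂ} (hb : EntireCoeff b) (n : ℕ) :
    EntireCoeff (eulerCoeff n b) := fun R hR => by
  -- The factor n + 2k is at most (n + 2)·2^k, and the 2^k is absorbed by doubling the radius.
  have h := (hb (2 * R) (by positivity)).mul_left ((n : ℝ) + 2)
  refine Summable.of_nonneg_of_le (fun k => by positivity) (fun k => ?_) h
  have hk : (k : ℝ) ≤ 2 ^ k := by exact_mod_cast Nat.lt_two_pow_self.le
  have h1 : (1 : ℝ) ≤ 2 ^ k := one_le_pow₀ (by norm_num)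
  have e : ‖(n : ℂ) + 2 * k‖ = (n : ℝ) + 2 * k := by
    rw [show (n : ℂ) + 2 * k = ((n + 2 * k : ℕ) : ℂ) by push_cast; ring, Complex.norm_natCast]
    push_cast; ring
  have h2 : (n : ℝ) + 2 * k ≤ (n + 2) * 2 ^ k := by
    nlinarith [(Nat.cast_nonneg n : (0 : ℝ) ≤ n)]
  rw [CanonicalLaplacian.eulerCoeff, norm_mul, e, mul_pow]
  calc ((n : ℝ) + 2 * k) * ‖b k‖ * R ^ k ≤ ((n + 2) * 2 ^ k) * ‖b k‖ * R ^ k := by gcongr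
    _ = _ := by ring

theorem EntireCoeff.add {b c : ℕ → ℂ} (hb : EntireCoeff b) (hc : EntireCoeff c) :
    EntireCoeff fun k => b k + c k := fun R hR => by
  refine Summable.of_nonneg_of_le (fun k => by positivity) (fun k => ?_) ((hb R hR).add (hc R hR))
  rw [← add_mul]
  exact mul_le_mul_of_nonneg_right (norm_add_le _ _) (by positivity)

theorem EntireCoeff.powerSum_hasDeriv {b : ℕ → ℂ} (hb : EntireCoeff b) (w : ℂ) :
    DifferentiableAt ℂ (powerSum b) w ∧
      HasSum (fun k => b k * (k * w ^ (k - 1))) (deriv (powerSum b) w) := by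
  set R : ℝ := ‖w‖ + 1
  have hR : 0 ≤ R := by positivity
  have hw : w ∈ Metric.ball (0 : ℂ) R := by simp [R]
  have hd : ∀ k : ℕ, DifferentiableOn ℂ (fun u : ℂ => b k * u ^ k) (Metric.ball 0 R) :=
    fun k => by fun_prop
  have hbd : ∀ k : ℕ, ∀ u ∈ Metric.ball (0 : ℂ) R, ‖b k * u ^ k‖ ≤ ‖b k‖ * R ^ k := by
    intro k u hu
    rw [norm_mul, norm_pow]
    have : ‖u‖ ≤ R := (by simpa using hu : ‖u‖ < R).le
    gcongr
  refine ⟨(Complex.differentiableOn_tsum_of_summable_norm (hb R hR) hd Metric.isOpen_ball hbd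
    |>.differentiableAt (Metric.isOpen_ball.mem_nhds hw)), ?_⟩
  have := Complex.hasSum_deriv_of_summable_norm (hb R hR) hd Metric.isOpen_ball hbd hw
  simp only [deriv_const_mul_field, deriv_pow_field] at this
  exact this

theorem EntireCoeff.differentiable {b : ℕ → ℂ} (hb : EntireCoeff b) :
    Differentiable ℂ (powerSum b) := fun w => (hb.powerSum_hasDeriv w).1

theorem EntireCoeff.powerSum_eulerCoeff {b : ℕ → ℂ} (hb : EntireCoeff b) (n : ℕ) (w : ℂ) :
    powerSum (CanonicalLaplacian.eulerCoeff n b) w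
      = n * powerSum b w + 2 * w * deriv (powerSum b) w := by
  have h1 := (hb.summable w).hasSum.mul_left (n : ℂ)
  have h2 := (hb.powerSum_hasDeriv w).2.mul_left (2 * w)
  refine (h1.add h2).tsum_eq ▸ ?_
  refine tsum_congr fun k => ?_
  rcases k with _ | k
  · simp [CanonicalLaplacian.eulerCoeff]
  · simp only [CanonicalLaplacian.eulerCoeff, Nat.add_sub_cancel, pow_succ]; ring

theorem powerSum_add {b c : ℕ → ℂ} (hb : EntireCoeff b) (hc : EntireCoeff c) (w : ℂ) :
    powerSum (fun k => b k + c k) w = powerSum b w + powerSum c w := by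
  rw [powerSum, powerSum, powerSum, ← (hb.summable w).tsum_add (hc.summable w)]
  exact tsum_congr fun k => by ring

theorem powerSum_const_mul (a : ℂ) (b : ℕ → ℂ) (w : ℂ) :
    powerSum (fun k => a * b k) w = a * powerSum b w := by
  rw [powerSum, powerSum, ← tsum_mul_left]
  exact tsum_congr fun k => by ring

theorem powerSum_zero (b : ℕ → ℂ) : powerSum b 0 = b 0 := by
  rw [powerSum, tsum_eq_single 0 (by intro k hk; simp [hk])]
  simp

theorem powerSum_conj {b : ℕ → ℂ} (h : ∀ k, star (b k) = b k) (w : ℂ) :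
    powerSum b (star w) = star (powerSum b w) := by
  rw [powerSum, powerSum, tsum_star]
  exact tsum_congr fun k => by rw [star_mul', star_pow, h]

theorem EntireCoeff.eq_zero {b : ℕ → ℂ} (hb : EntireCoeff b) (h : ∀ w, powerSum b w = 0) (k : ℕ) :
    b k = 0 := by
  have key : HasFPowerSeriesOnBall (powerSum b) (FormalMultilinearSeries.ofScalars ℂ b) 0 1 := by
    refine ⟨?_, by norm_num, fun {y} _ => ?_⟩
    · refine (FormalMultilinearSeries.ofScalars ℂ b).le_radius_of_summable (r := 1) ?_
      refine Summable.of_nonneg_of_le (fun k => by positivity) (fun k => ?_) (hb 1 zero_le_one)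
      gcongr
      · rw [FormalMultilinearSeries.ofScalars_norm]
      · simp
    · have := (hb.summable y).hasSum
      simpa [FormalMultilinearSeries.ofScalars_apply_eq, powerSum, zero_add, mul_comm] using this
  have h0 : powerSum b = 0 := funext h
  rw [h0] at key
  have := key.hasFPowerSeriesAt.eq_zero
  have h2 := congrArg (fun p => p.coeff k) this
  simp only [FormalMultilinearSeries.coeff_ofScalars] at h2
  simpa [FormalMultilinearSeries.coeff] using h2

/-- The operator z d/dz multiplies z^(n+2k) by n + 2k. Since `eulerCoeff` can be iterated, this one
formula yields both the first and the second derivatives of the Bessel functions. -/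
theorem EntireCoeff.hasDerivAt_pow_mul {b : ℕ → ℂ} (hb : EntireCoeff b) (n : ℕ) (w z : ℂ)
    (hz : z ≠ 0) :
    HasDerivAt (fun z : ℂ => z ^ n * powerSum b (w * z ^ 2))
      (z ^ n * powerSum (CanonicalLaplacian.eulerCoeff n b) (w * z ^ 2) / z) z := by
  have h1 := (hb.differentiable (w * z ^ 2)).hasDerivAt
  have h2 : HasDerivAt (fun z : ℂ => w * z ^ 2) (w * (2 * z)) z := by
    simpa using (hasDerivAt_pow 2 z).const_mul w
  have h3 := (hasDerivAt_pow n z).mul (h1.comp z h2)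
  refine h3.congr_deriv ?_
  rw [hb.powerSum_eulerCoeff]
  rcases n with _ | n
  · simp; field_simp
  · simp only [Nat.add_sub_cancel, pow_succ, Function.comp]; field_simp

/-! ### The Bessel series -/

/-- The coefficients of `E_n`, where `J_n(z) = (z / 2)^n E_n(z²)`. -/
noncomputable def besselCoeff (n k : ℕ) : ℂ :=
  (-1 / 4) ^ k / ((k.factorial : ℂ) * ((n + k).factorial : ℂ))

/-- The entire function `E_n` with `J_n(z) = (z / 2)^n E_n(z²)`. -/
noncomputable def besselE (n : ℕ) : ℂ → ℂ := powerSum (besselCoeff n)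

/-- The entire function `B_n` with `z J_n'(z) = (z / 2)^n B_n(z²)`. -/
noncomputable def besselB (n : ℕ) : ℂ → ℂ := powerSum (eulerCoeff n (besselCoeff n))

theorem norm_besselCoeff_le (n k : ℕ) : ‖besselCoeff n k‖ ≤ 1 / k.factorial := by
  rw [besselCoeff, norm_div, norm_mul, norm_pow, Complex.norm_natCast, Complex.norm_natCast]
  have h1 : (1 : ℝ) ≤ ((n + k).factorial : ℝ) := by exact_mod_cast Nat.factorial_pos _
  have h2 : (0 : ℝ) < (k.factorial : ℝ) := by exact_mod_cast Nat.factorial_pos _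
  have h3 : ‖(-1 / 4 : ℂ)‖ ^ k ≤ 1 := pow_le_one₀ (norm_nonneg _) (by norm_num)
  exact div_le_div₀ zero_le_one h3 h2 (by nlinarith)

theorem entireCoeff_bessel (n : ℕ) : EntireCoeff (besselCoeff n) := fun R hR => by
  refine Summable.of_nonneg_of_le (fun k => by positivity) (fun k => ?_)
    (Real.summable_pow_div_factorial R)
  calc ‖besselCoeff n k‖ * R ^ k ≤ 1 / k.factorial * R ^ k :=
        mul_le_mul_of_nonneg_right (norm_besselCoeff_le n k) (by positivity)
    _ = _ := by ring

theorem besselCoeff_ne_zero (n k : ℕ) : besselCoeff n k ≠ 0 := by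
  have h1 : (k.factorial : ℂ) ≠ 0 := by exact_mod_cast Nat.factorial_ne_zero _
  have h2 : ((n + k).factorial : ℂ) ≠ 0 := by exact_mod_cast Nat.factorial_ne_zero _
  rw [besselCoeff]
  exact div_ne_zero (pow_ne_zero _ (by norm_num)) (mul_ne_zero h1 h2)

theorem star_besselCoeff (n k : ℕ) : star (besselCoeff n k) = besselCoeff n k := by
  rw [besselCoeff, star_div₀, star_mul', star_pow, star_natCast, star_natCast]
  norm_num

theorem differentiable_besselE (n : ℕ) : Differentiable ℂ (besselE n) :=
  (entireCoeff_bessel n).differentiable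

theorem differentiable_besselB (n : ℕ) : Differentiable ℂ (besselB n) :=
  ((entireCoeff_bessel n).eulerCoeff n).differentiable

theorem besselE_conj (n : ℕ) (w : ℂ) : besselE n (star w) = star (besselE n w) :=
  powerSum_conj (star_besselCoeff n) w

theorem besselB_conj (n : ℕ) (w : ℂ) : besselB n (star w) = star (besselB n w) :=
  powerSum_conj (fun k => by
    rw [eulerCoeff, star_mul', star_besselCoeff, star_add, star_mul']; simp) w

theorem besselE_zero_ne (n : ℕ) : besselE n 0 ≠ 0 := by
  rw [besselE, powerSum_zero]; exact besselCoeff_ne_zero n 0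

theorem besselE_zero_zero : besselE 0 0 = 1 := by
  simp [besselE, powerSum_zero, besselCoeff]

theorem besselB_zero_iff (n : ℕ) : besselB n 0 = 0 ↔ n = 0 := by
  rw [besselB, powerSum_zero, eulerCoeff]
  simp [besselCoeff_ne_zero]

/-- Bessel's differential equation on the level of power series. -/
theorem powerSum_eulerCoeff_eulerCoeff (n : ℕ) (w : ℂ) :
    powerSum (eulerCoeff n (eulerCoeff n (besselCoeff n))) w = ((n : ℂ) ^ 2 - w) * besselE n w := by
  have hE := entireCoeff_bessel n
  have h0 : HasSum (fun k => eulerCoeff n (eulerCoeff n (besselCoeff n)) k * w ^ k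
      - (n : ℂ) ^ 2 * (besselCoeff n k * w ^ k))
      (powerSum (eulerCoeff n (eulerCoeff n (besselCoeff n))) w - (n : ℂ) ^ 2 * besselE n w) :=
    (((hE.eulerCoeff n).eulerCoeff n).summable w).hasSum.sub
      (((hE.summable w).hasSum).mul_left _)
  have h1 : HasSum (fun k => -w * (besselCoeff n k * w ^ k)) (-w * besselE n w) :=
    ((hE.summable w).hasSum).mul_left _
  -- The term k = 0 is (n² - n²)c_0 = 0. After the shift, (n + 2k + 2)² - n² = 4(k + 1)(n + k + 1)
  -- cancels against the recursion for the coefficients.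
  rw [← hasSum_nat_add_iff' 1] at h0
  have h2 : (fun k => eulerCoeff n (eulerCoeff n (besselCoeff n)) (k + 1) * w ^ (k + 1)
      - (n : ℂ) ^ 2 * (besselCoeff n (k + 1) * w ^ (k + 1)))
      = fun k => -w * (besselCoeff n k * w ^ k) := by
    funext k
    have e : besselCoeff n (k + 1) * (4 * (k + 1) * (n + k + 1)) = - besselCoeff n k := by
      have h1 : (k.factorial : ℂ) ≠ 0 := by exact_mod_cast Nat.factorial_ne_zero _
      have h2 : ((n + k).factorial : ℂ) ≠ 0 := by exact_mod_cast Nat.factorial_ne_zero _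
      have h3 : (k + 1 : ℂ) ≠ 0 := by exact_mod_cast Nat.succ_ne_zero k
      have h4 : (n + k + 1 : ℂ) ≠ 0 := by exact_mod_cast Nat.succ_ne_zero (n + k)
      rw [besselCoeff, besselCoeff, ← add_assoc n k 1, Nat.factorial_succ, Nat.factorial_succ]
      push_cast
      field_simp
      ring
    rw [eulerCoeff, eulerCoeff]
    push_cast
    linear_combination w ^ (k + 1) * e
  rw [h2] at h0
  have h3 := h0.unique h1
  simp [eulerCoeff] at h3
  linear_combination h3

theorem besselJNat_eq (n : ℕ) (z : ℂ) : besselJNat n z = (z / 2) ^ n * besselE n (z ^ 2) := by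
  rw [besselJNat, besselE, powerSum, ← tsum_mul_left]
  refine tsum_congr fun k => ?_
  rw [besselCoeff, pow_add, pow_mul, div_pow z 2 2, div_pow (z ^ 2), div_pow (-1 : ℂ)]
  norm_num
  ring

/-- The sign `κ` with `J_ν = κ J_{|ν|}`. -/
def besselSign : ℤ → ℂ
  | Int.ofNat _ => 1
  | Int.negSucc n => (-1) ^ (n + 1)

theorem besselSign_ne_zero (ν : ℤ) : besselSign ν ≠ 0 := by
  cases ν <;> simp [besselSign]

theorem besselJ_eq (ν : ℤ) (z : ℂ) :
    besselJ ν z = besselSign ν * ((z / 2) ^ ν.natAbs * besselE ν.natAbs (z ^ 2)) := by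
  cases ν with
  | ofNat n => simp [besselJ, besselSign, besselJNat_eq]
  | negSucc n => simp [besselJ, besselSign, besselJNat_eq]

theorem hasDerivAt_besselJ (ν : ℤ) {z : ℂ} (hz : z ≠ 0) :
    HasDerivAt (besselJ ν)
      (besselSign ν * ((z / 2) ^ ν.natAbs * besselB ν.natAbs (z ^ 2)) / z) z := by
  have h := ((entireCoeff_bessel ν.natAbs).hasDerivAt_pow_mul ν.natAbs 1 z hz).const_mul
    (besselSign ν / 2 ^ ν.natAbs)
  simp only [one_mul] at h
  have e : besselJ ν = fun z : ℂ => besselSign ν / 2 ^ ν.natAbs *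
      (z ^ ν.natAbs * powerSum (besselCoeff ν.natAbs) (z ^ 2)) := by
    funext u; rw [besselJ_eq, besselE, div_pow]; ring
  rw [e]
  refine h.congr_deriv ?_
  rw [show besselB ν.natAbs (z ^ 2) = powerSum _ (z ^ 2) from rfl, div_pow]; ring

theorem besselJ_eq_zero_iff (ν : ℤ) {z : ℂ} (hz : z ≠ 0) :
    besselJ ν z = 0 ↔ besselE ν.natAbs (z ^ 2) = 0 := by
  simp [besselJ_eq, besselSign_ne_zero, hz]

theorem deriv_besselJ_eq_zero_iff (ν : ℤ) {z : ℂ} (hz : z ≠ 0) :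
    deriv (besselJ ν) z = 0 ↔ besselB ν.natAbs (z ^ 2) = 0 := by
  rw [(hasDerivAt_besselJ ν hz).deriv]
  simp [besselSign_ne_zero, hz]

theorem mem_zeroSet_iff (ν : ℤ) (z : ℂ) :
    z ∈ zeroSet 0 ν ↔
      z ≠ 0 ∧ (besselE ν.natAbs (z ^ 2) = 0 ∨ besselB ν.natAbs (z ^ 2) = 0) := by
  rw [zeroSet, Set.mem_ofPred_eq]
  refine and_congr_right fun hz => ?_
  have h := (hasDerivAt_besselJ ν hz).differentiableAt.hasDerivAt
  have e : besselL 0 ν z = -(2 * (besselJ ν z * deriv (besselJ ν) z)) := by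
    have := (h.mul h).deriv
    simp only [besselL, pow_zero, Nat.cast_zero, neg_zero, zpow_zero, one_mul, sub_zero]
    rw [show (fun w => besselJ ν w * besselJ ν w) = besselJ ν * besselJ ν from rfl, this]
    ring
  rw [e, ← besselJ_eq_zero_iff ν hz, ← deriv_besselJ_eq_zero_iff ν hz]
  simp

/-! ### Radial eigenfunctions on the unit disc -/

/-- The radial function `r ↦ r^n E_n(w r²)`, a multiple of `J_n(√w r)`. -/
noncomputable def radial (n : ℕ) (w : ℂ) (r : ℝ) : ℂ := (r : ℂ) ^ n * besselE n (w * (r : ℂ) ^ 2)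

/-- The Euler derivative of `radial n w`. -/
noncomputable def radialB (n : ℕ) (w : ℂ) (r : ℝ) : ℂ := (r : ℂ) ^ n * besselB n (w * (r : ℂ) ^ 2)

/-- The squared norm of `radial n w` with respect to `r dr` on the unit interval. -/
noncomputable def radialNormSq (n : ℕ) (w : ℂ) : ℝ := ∫ r in (0 : ℝ)..1, r * ‖radial n w r‖ ^ 2

theorem continuous_uncurry_radial (n : ℕ) : Continuous fun p : ℂ × ℝ => radial n p.1 p.2 := by
  have := (differentiable_besselE n).continuous
  unfold radial
  fun_prop

theorem continuous_radial (n : ℕ) (w : ℂ) : Continuous (radial n w) := by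
  have := (differentiable_besselE n).continuous
  unfold radial
  fun_prop

theorem continuous_radialB (n : ℕ) (w : ℂ) : Continuous (radialB n w) := by
  have := (differentiable_besselB n).continuous
  unfold radialB
  fun_prop

theorem radial_one (n : ℕ) (w : ℂ) : radial n w 1 = besselE n w := by simp [radial]

theorem radialB_one (n : ℕ) (w : ℂ) : radialB n w 1 = besselB n w := by simp [radialB]

theorem radial_conj (n : ℕ) (w : ℂ) (r : ℝ) : radial n (star w) r = star (radial n w r) := by
  have : star w * (r : ℂ) ^ 2 = star (w * (r : ℂ) ^ 2) := by simp
  rw [radial, radial, this, besselE_conj]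
  simp

theorem hasDerivAt_radial (n : ℕ) (w : ℂ) {r : ℝ} (hr : r ≠ 0) :
    HasDerivAt (radial n w) (radialB n w r / r) r :=
  ((entireCoeff_bessel n).hasDerivAt_pow_mul n w r (by exact_mod_cast hr)).comp_ofReal

theorem hasDerivAt_radialB (n : ℕ) (w : ℂ) {r : ℝ} (hr : r ≠ 0) :
    HasDerivAt (radialB n w) (((n : ℂ) ^ 2 - w * (r : ℂ) ^ 2) * radial n w r / r) r := by
  refine (((entireCoeff_bessel n).eulerCoeff n).hasDerivAt_pow_mul n w r
    (by exact_mod_cast hr)).comp_ofReal.congr_deriv ?_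
  rw [powerSum_eulerCoeff_eulerCoeff, radial]; ring

/-- Lagrange's identity: with ϑ = r d/dr, both functions satisfy ϑ²R = (n² - wr²)R for their own
parameter, so the derivative of the Wronskian is (w - μ) r R_w R_μ. -/
theorem integral_radial_mul_radial (n : ℕ) (w μ : ℂ) :
    (w - μ) * ∫ r in (0 : ℝ)..1, (r : ℂ) * (radial n w r * radial n μ r) =
      besselE n w * besselB n μ - besselB n w * besselE n μ := by
  have hw := continuous_radial n w
  have hm := continuous_radial n μ
  have hw' := continuous_radialB n w
  have hm' := continuous_radialB n μ
  have h := intervalIntegral.integral_eq_sub_of_hasDerivAt_of_le (a := 0) (b := 1)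
    (f := fun r => radial n w r * radialB n μ r - radialB n w r * radial n μ r)
    (f' := fun r => (w - μ) * ((r : ℂ) * (radial n w r * radial n μ r))) zero_le_one
    (by fun_prop) (fun r hr => by
      have hr0 : r ≠ 0 := hr.1.ne'
      have hr1 : (r : ℂ) ≠ 0 := by exact_mod_cast hr0
      refine (((hasDerivAt_radial n w hr0).mul (hasDerivAt_radialB n μ hr0)).sub
        ((hasDerivAt_radialB n w hr0).mul (hasDerivAt_radial n μ hr0))).congr_deriv ?_
      field_simp
      ring) (Continuous.intervalIntegrable (by fun_prop) _ _)
  rw [intervalIntegral.integral_const_mul] at h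
  rw [h]
  simp only [radial_one, radialB_one]
  -- At r = 0 the Wronskian vanishes through the factor r^n if n ≥ 1, and through B_0(0) = 0 if n =
  -- 0.
  rcases n with _ | n
  · have h0 : besselB 0 0 = 0 := (besselB_zero_iff 0).2 rfl
    simp [radial, radialB, h0]
  · simp [radial, radialB]

/-- The Wronskian of R_w with the test function r^(n+2), whose boundary values are 1 and n + 2. It
makes a combination of E_n(w) and B_n(w) controllable by the norm of R_w; the factor 4n + 4 is (n +
2)² - n². -/
theorem integral_radial_mul_pow (n : ℕ) (w : ℂ) :
    ∫ r in (0 : ℝ)..1, (r : ℂ) * (radial n w r * ((r : ℂ) ^ n * (4 * n + 4 + w * (r : ℂ) ^ 2))) =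
      (n + 2) * besselE n w - besselB n w := by
  have hw := continuous_radial n w
  have hw' := continuous_radialB n w
  have h := intervalIntegral.integral_eq_sub_of_hasDerivAt_of_le (a := 0) (b := 1)
    (f := fun r : ℝ => ((n + 2 : ℕ) * radial n w r - radialB n w r) * (r : ℂ) ^ (n + 2))
    (f' := fun r : ℝ => (r : ℂ) * (radial n w r * ((r : ℂ) ^ n * (4 * n + 4 + w * (r : ℂ) ^ 2))))
    zero_le_one
    (by fun_prop) (fun r hr => by
      have hr0 : r ≠ 0 := hr.1.ne'
      have hr1 : (r : ℂ) ≠ 0 := by exact_mod_cast hr0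
      have hp : HasDerivAt (fun r : ℝ => (r : ℂ) ^ (n + 2)) (((n + 2 : ℕ) : ℂ) * (r : ℂ) ^ (n + 1)) r :=
        (hasDerivAt_pow (n + 2) (r : ℂ)).comp_ofReal
      refine ((((hasDerivAt_radial n w hr0).const_mul ((n + 2 : ℕ) : ℂ)).sub
        (hasDerivAt_radialB n w hr0)).mul hp).congr_deriv ?_
      simp only [pow_succ, Pi.sub_apply]
      push_cast
      field_simp
      ring) (Continuous.intervalIntegrable (by fun_prop) _ _)
  rw [h]
  simp [radial_one, radialB_one]

theorem radialNormSq_pos (n : ℕ) (w : ℂ) : 0 < radialNormSq n w := by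
  have hc := continuous_radial n w
  refine intervalIntegral.integral_pos zero_lt_one (by fun_prop)
    (fun r hr => mul_nonneg hr.1.le (by positivity)) ?_
  have h1 : ContinuousAt (fun r : ℝ => besselE n (w * (r : ℂ) ^ 2)) 0 := by
    have := (differentiable_besselE n).continuous
    fun_prop
  have h2 : ∀ᶠ r : ℝ in nhds 0, besselE n (w * (r : ℂ) ^ 2) ≠ 0 :=
    h1.eventually_ne (by simpa using besselE_zero_ne n)
  obtain ⟨r, hr, hr'⟩ := ((h2.filter_mono nhdsWithin_le_nhds).and
    (Ioo_mem_nhdsGT (zero_lt_one (α := ℝ)))).exists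
  refine ⟨r, ⟨hr'.1.le, hr'.2.le⟩, mul_pos hr'.1 (pow_pos (norm_pos_iff.2 ?_) 2)⟩
  exact mul_ne_zero (pow_ne_zero _ (by exact_mod_cast hr'.1.ne')) hr

theorem integral_radial_mul_star (n : ℕ) (w : ℂ) :
    ∫ r in (0 : ℝ)..1, (r : ℂ) * (radial n w r * star (radial n w r)) = radialNormSq n w := by
  rw [radialNormSq, ← intervalIntegral.integral_ofReal]
  refine intervalIntegral.integral_congr fun r _ => ?_
  have : radial n w r * star (radial n w r) = ((‖radial n w r‖ ^ 2 : ℝ) : ℂ) := by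
    push_cast; exact Complex.mul_conj' _
  simp only [this]
  push_cast; ring

/-- Lagrange's identity with μ the conjugate of w: the left side becomes 2i Im(w) times the squared
norm. In particular E_n and B_n have only real zeros. -/
theorem radialNormSq_mul_im_le (n : ℕ) (w : ℂ) :
    radialNormSq n w * |w.im| ≤ ‖besselE n w‖ * ‖besselB n w‖ := by
  have h := integral_radial_mul_radial n w (star w)
  simp only [radial_conj, integral_radial_mul_star, besselE_conj, besselB_conj] at h
  have h1 : ‖w - star w‖ = 2 * |w.im| := by
    have : w - star w = ((2 * w.im : ℝ) : ℂ) * Complex.I := by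
      simpa using Complex.sub_conj w
    rw [this]; simp
  have h2 := congrArg norm h
  rw [norm_mul, h1, Complex.norm_real, Real.norm_of_nonneg (radialNormSq_pos n w).le] at h2
  have h3 := norm_sub_le (besselE n w * star (besselB n w)) (besselB n w * star (besselE n w))
  rw [norm_mul, norm_mul, norm_star, norm_star] at h3
  linarith

/-- Cauchy-Schwarz against the constant I for the measure r dr, whose total mass 1/2 is at most 1.
-/
theorem integral_norm_radial_sq_le (n : ℕ) (w : ℂ) :
    (∫ r in (0 : ℝ)..1, r * ‖radial n w r‖) ^ 2 ≤ radialNormSq n w := by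
  have hc := continuous_radial n w
  set I := ∫ r in (0 : ℝ)..1, r * ‖radial n w r‖ with hI
  have h0 : 0 ≤ ∫ r in (0 : ℝ)..1, r * (‖radial n w r‖ - I) ^ 2 :=
    intervalIntegral.integral_nonneg zero_le_one fun r hr => mul_nonneg hr.1 (sq_nonneg _)
  have h1 : ∫ r in (0 : ℝ)..1, r * (‖radial n w r‖ - I) ^ 2 =
      ∫ r in (0 : ℝ)..1, ((r * ‖radial n w r‖ ^ 2 - 2 * I * (r * ‖radial n w r‖)) + I ^ 2 * r) := by
    congr 1; funext r; ring
  have i1 : IntervalIntegrable (fun r : ℝ => r * ‖radial n w r‖ ^ 2) volume 0 1 :=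
    Continuous.intervalIntegrable (by fun_prop) _ _
  have i2 : IntervalIntegrable (fun r : ℝ => 2 * I * (r * ‖radial n w r‖)) volume 0 1 :=
    Continuous.intervalIntegrable (by fun_prop) _ _
  have i3 : IntervalIntegrable (fun r : ℝ => I ^ 2 * r) volume 0 1 :=
    Continuous.intervalIntegrable (by fun_prop) _ _
  rw [h1, intervalIntegral.integral_add (i1.sub i2) i3, intervalIntegral.integral_sub i1 i2,
    intervalIntegral.integral_const_mul, intervalIntegral.integral_const_mul, integral_id, ← hI,
    ← radialNormSq] at h0
  nlinarith [sq_nonneg I]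

theorem norm_sub_besselB_le (n : ℕ) {w : ℂ} (hw : 1 ≤ ‖w‖) :
    ‖((n : ℂ) + 2) * besselE n w - besselB n w‖ ≤
      (4 * n + 5) * ‖w‖ * √(radialNormSq n w) := by
  rw [← integral_radial_mul_pow]
  have hc := continuous_radial n w
  have h1 : ∀ r ∈ Set.Icc (0 : ℝ) 1,
      ‖(r : ℂ) * (radial n w r * ((r : ℂ) ^ n * (4 * n + 4 + w * (r : ℂ) ^ 2)))‖ ≤
        (4 * n + 5) * ‖w‖ * (r * ‖radial n w r‖) := by
    rintro r ⟨hr0, hr1⟩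
    have e1 : ‖(4 * n + 4 + w * (r : ℂ) ^ 2 : ℂ)‖ ≤ (4 * n + 5) * ‖w‖ := by
      have : ‖(4 * n + 4 : ℂ)‖ = 4 * n + 4 := by
        rw [show (4 * n + 4 : ℂ) = ((4 * n + 4 : ℕ) : ℂ) by push_cast; ring, Complex.norm_natCast]
        push_cast; ring
      refine (norm_add_le _ _).trans ?_
      rw [this, norm_mul, norm_pow, Complex.norm_real, Real.norm_of_nonneg hr0]
      have : r ^ 2 ≤ 1 := pow_le_one₀ hr0 hr1
      nlinarith [norm_nonneg w, (Nat.cast_nonneg n : (0 : ℝ) ≤ n)]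
    have e2 : r ^ n ≤ 1 := pow_le_one₀ hr0 hr1
    rw [norm_mul, norm_mul, norm_mul, norm_pow, Complex.norm_real, Real.norm_of_nonneg hr0]
    calc r * (‖radial n w r‖ * (r ^ n * ‖(4 * n + 4 + w * (r : ℂ) ^ 2 : ℂ)‖))
        ≤ r * (‖radial n w r‖ * (1 * ((4 * n + 5) * ‖w‖))) := by gcongr
      _ = _ := by ring
  have h2 := intervalIntegral.norm_integral_le_of_norm_le (a := (0 : ℝ)) (b := 1) (μ := volume)
    (f := fun r : ℝ =>
      (r : ℂ) * (radial n w r * ((r : ℂ) ^ n * (4 * n + 4 + w * (r : ℂ) ^ 2)))) zero_le_one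
    (ae_of_all _ fun r hr => h1 r ⟨hr.1.le, hr.2⟩) (Continuous.intervalIntegrable (by fun_prop) _ _)
  rw [intervalIntegral.integral_const_mul] at h2
  refine h2.trans (mul_le_mul_of_nonneg_left ?_ (by positivity))
  exact Real.le_sqrt_of_sq_le (integral_norm_radial_sq_le n w)

/-! ### The two boundary functions -/

/-- The boundary functions: `E_n` (Dirichlet) for `false`, `B_n` (Neumann) for `true`. -/
noncomputable def besselD (n : ℕ) : Bool → ℂ → ℂ
  | true => besselB n
  | false => besselE n

theorem differentiable_besselD (n : ℕ) (s : Bool) : Differentiable ℂ (besselD n s) := by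
  cases s
  · exact differentiable_besselE n
  · exact differentiable_besselB n

theorem im_eq_zero_of_besselD_eq_zero {n : ℕ} {s : Bool} {w : ℂ} (h : besselD n s w = 0) :
    w.im = 0 := by
  have h1 := radialNormSq_mul_im_le n w
  have h2 : ‖besselE n w‖ * ‖besselB n w‖ = 0 := by
    cases s <;> simp_all [besselD]
  have h3 := radialNormSq_pos n w
  rw [h2] at h1
  exact abs_eq_zero.1 (le_antisymm (nonpos_of_mul_nonpos_right h1 h3) (abs_nonneg _))

theorem star_eq_of_besselD_eq_zero {n : ℕ} {s : Bool} {w : ℂ} (h : besselD n s w = 0) :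
    star w = w :=
  Complex.conj_eq_iff_im.2 (im_eq_zero_of_besselD_eq_zero h)

theorem integral_radial_orthogonal {n : ℕ} {s : Bool} {w μ : ℂ} (hw : besselD n s w = 0)
    (hm : besselD n s μ = 0) (hne : w ≠ μ) :
    ∫ r in (0 : ℝ)..1, (r : ℂ) * (radial n w r * radial n μ r) = 0 := by
  have h := integral_radial_mul_radial n w μ
  have h2 : besselE n w * besselB n μ - besselB n w * besselE n μ = 0 := by
    cases s <;> simp_all [besselD]
  rw [h2] at h
  exact (mul_eq_zero.1 h).resolve_left (sub_ne_zero.2 hne)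

/-- Continuity of g suffices because the slope at μ is g itself. This lets Lagrange's identity be
differentiated at w = μ without differentiating under the integral. -/
theorem hasDerivAt_sub_mul {g : ℂ → ℂ} {μ : ℂ} (hg : ContinuousAt g μ) :
    HasDerivAt (fun w => (w - μ) * g w) (g μ) μ := by
  rw [hasDerivAt_iff_tendsto_slope]
  refine (hg.tendsto.mono_left nhdsWithin_le_nhds).congr' ?_
  filter_upwards [self_mem_nhdsWithin] with w hw
  have : w - μ ≠ 0 := sub_ne_zero.2 hw
  simp [slope, this]

/-- The derivative of Lagrange's identity in w at w = μ; for real μ the integrand is r|R_μ|². -/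
theorem deriv_mul_sub_deriv_mul {n : ℕ} {μ : ℂ} (hm : star μ = μ) :
    deriv (besselE n) μ * besselB n μ - deriv (besselB n) μ * besselE n μ = radialNormSq n μ := by
  have hc : Continuous fun w => ∫ r in (0 : ℝ)..1, (r : ℂ) * (radial n w r * radial n μ r) := by
    refine intervalIntegral.continuous_parametric_intervalIntegral_of_continuous' ?_ 0 1
    have h1 := continuous_uncurry_radial n
    have h2 := continuous_radial n μ
    simp only [Function.uncurry_def]
    fun_prop
  have h1 := hasDerivAt_sub_mul (μ := μ) hc.continuousAt
  simp only [integral_radial_mul_radial] at h1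
  have h2 := ((differentiable_besselE n μ).hasDerivAt.mul_const (besselB n μ)).sub
    ((differentiable_besselB n μ).hasDerivAt.mul_const (besselE n μ))
  rw [h2.unique h1, ← integral_radial_mul_star]
  simp only [← radial_conj, hm]

/-- A double zero would annihilate both terms of the differentiated identity, whose value is a
positive squared norm. -/
theorem deriv_besselD_ne_zero {n : ℕ} {s : Bool} {μ : ℂ} (h : besselD n s μ = 0) :
    deriv (besselD n s) μ ≠ 0 := fun h' => by
  have h1 := deriv_mul_sub_deriv_mul (n := n) (star_eq_of_besselD_eq_zero h)
  have h2 : (radialNormSq n μ : ℂ) ≠ 0 := by exact_mod_cast (radialNormSq_pos n μ).ne'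
  refine h2 (h1.symm.trans ?_)
  cases s <;> simp_all [besselD]

theorem besselB_ne_zero {n : ℕ} {μ : ℂ} (h : besselE n μ = 0) : besselB n μ ≠ 0 := fun h' => by
  have h1 := deriv_mul_sub_deriv_mul (n := n) (star_eq_of_besselD_eq_zero (s := false) h)
  have h2 : (radialNormSq n μ : ℂ) ≠ 0 := by exact_mod_cast (radialNormSq_pos n μ).ne'
  exact h2 (h1.symm.trans (by simp [h, h']))

/-! ### Lower bound for the boundary functions off the real axis -/

theorem le_of_sq_le_add {X W p a c : ℝ} (hW : 1 ≤ W) (hp : 0 ≤ p) (ha : 1 ≤ a)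
    (hc : 0 ≤ c) (h : X ^ 2 ≤ a * W * p ^ 2 + c * W * p * X) : X ≤ (a + c) * W * p := by
  by_contra! hlt
  have h1 : p ≤ (a + c) * W * p := by
    have : 1 ≤ (a + c) * W := by nlinarith
    nlinarith
  have h2 : 0 < X := lt_of_le_of_lt (hp.trans h1) hlt
  have h3 : a * W * p * p ≤ a * W * p * X :=
    mul_le_mul_of_nonneg_left (h1.trans hlt.le) (by positivity)
  nlinarith [mul_lt_mul_of_pos_right hlt h2]

/-- Write x for the norm of R_w, y = |Im w|, p = |E_n(w)|, q = |B_n(w)|, W = |w|. Then x²y ≤ pq,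
while p and q control each other up to a multiple of Wx. Eliminating the unwanted one of p, q leaves
a quadratic inequality for xy, which `le_of_sq_le_add` solves. -/
theorem exists_sqrt_radialNormSq_mul_im_le (n : ℕ) (s : Bool) :
    ∃ C : ℝ, 0 ≤ C ∧ ∀ w : ℂ, 1 ≤ ‖w‖ →
      √(radialNormSq n w) * |w.im| ≤ C * ‖w‖ * ‖besselD n s w‖ := by
  refine ⟨(n + 2) + (4 * n + 5), by positivity, fun w hw => ?_⟩
  have hN := radialNormSq_mul_im_le n w
  have hT := norm_sub_besselB_le n hw
  set x := √(radialNormSq n w) with hx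
  have hx2 : x ^ 2 = radialNormSq n w := Real.sq_sqrt (radialNormSq_pos n w).le
  have hx0 : 0 ≤ x := Real.sqrt_nonneg _
  rw [← hx2] at hN
  have hy : |w.im| ≤ ‖w‖ := Complex.abs_im_le_norm w
  have hy0 := abs_nonneg w.im
  have hp0 := norm_nonneg (besselE n w)
  have hq0 := norm_nonneg (besselB n w)
  have hn0 : (0 : ℝ) ≤ n := Nat.cast_nonneg n
  have hnn : ‖((n : ℂ) + 2) * besselE n w‖ = (n + 2) * ‖besselE n w‖ := by
    rw [norm_mul, show (n : ℂ) + 2 = ((n + 2 : ℕ) : ℂ) by push_cast; ring, Complex.norm_natCast]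
    push_cast; ring
  have hA : (n + 2) * ‖besselE n w‖ ≤ ‖besselB n w‖ + (4 * n + 5) * ‖w‖ * x := by
    have := norm_sub_norm_le (((n : ℂ) + 2) * besselE n w) (besselB n w)
    rw [hnn] at this
    linarith
  have hB : ‖besselB n w‖ ≤ (n + 2) * ‖besselE n w‖ + (4 * n + 5) * ‖w‖ * x := by
    have := norm_sub_norm_le (besselB n w) (((n : ℂ) + 2) * besselE n w)
    rw [hnn, norm_sub_rev] at this
    linarith
  set p := ‖besselE n w‖
  set q := ‖besselB n w‖
  set y := |w.im|
  set W := ‖w‖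
  have e0 : (x * y) ^ 2 ≤ p * q * y := by
    calc (x * y) ^ 2 = (x ^ 2 * y) * y := by ring
      _ ≤ p * q * y := mul_le_mul_of_nonneg_right hN hy0
  cases s
  · change _ ≤ ((n + 2 : ℝ) + (4 * n + 5)) * W * p
    refine le_of_sq_le_add hw hp0 (by linarith) (by positivity) (e0.trans ?_)
    calc p * q * y ≤ p * ((n + 2) * p + (4 * n + 5) * W * x) * y := by gcongr
      _ = (n + 2) * y * p ^ 2 + (4 * n + 5) * W * p * (x * y) := by ring
      _ ≤ _ := by gcongr
  · have h : x * y ≤ (1 + (4 * n + 5)) * W * q := by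
      refine le_of_sq_le_add hw hq0 le_rfl (by positivity) (e0.trans ?_)
      calc p * q * y ≤ ((n + 2) * p) * q * y := by
            have : p ≤ (n + 2) * p := by nlinarith
            gcongr
        _ ≤ (q + (4 * n + 5) * W * x) * q * y := by gcongr
        _ = y * q ^ 2 + (4 * n + 5) * W * q * (x * y) := by ring
        _ ≤ _ := by gcongr; linarith
    refine h.trans ?_
    change _ ≤ ((n + 2 : ℝ) + (4 * n + 5)) * W * q
    gcongr
    linarith

/-! ### Entire functions controlled by the imaginary part -/

-- Near a zero a of D, both F and D are w - a times their `dslope` at a, and that of D does not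
-- vanish at a because the zero is simple.
open Filter Topology in
theorem exists_entire_quotient {F D : ℂ → ℂ} (hF : Differentiable ℂ F) (hD : Differentiable ℂ D)
    (h : ∀ w, D w = 0 → F w = 0 ∧ deriv D w ≠ 0) :
    ∃ K : ℂ → ℂ, Differentiable ℂ K ∧ ∀ w, F w = K w * D w := by
  classical
  refine ⟨fun w => if D w = 0 then deriv F w / deriv D w else F w / D w, fun a => ?_, fun w => ?_⟩
  · by_cases ha : D a = 0
    · obtain ⟨hFa, hda⟩ := h a ha
      have h1 : Differentiable ℂ (dslope F a) := by
        rw [← differentiableOn_univ, Complex.differentiableOn_dslope univ_mem]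
        exact hF.differentiableOn
      have h2 : Differentiable ℂ (dslope D a) := by
        rw [← differentiableOn_univ, Complex.differentiableOn_dslope univ_mem]
        exact hD.differentiableOn
      have h3 : ∀ᶠ w in 𝓝 a, dslope D a w ≠ 0 :=
        h2.continuous.continuousAt.eventually_ne (by rwa [dslope_same])
      have h4 : (fun w => if D w = 0 then deriv F w / deriv D w else F w / D w) =ᶠ[𝓝 a]
          fun w => dslope F a w / dslope D a w := by
        filter_upwards [h3] with w hw
        rcases eq_or_ne w a with rfl | hwa
        · simp [ha, dslope_same]
        · have e1 := sub_smul_dslope F a w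
          have e2 := sub_smul_dslope D a w
          have hs : w - a ≠ 0 := sub_ne_zero.2 hwa
          rw [hFa, sub_zero, smul_eq_mul] at e1
          rw [ha, sub_zero, smul_eq_mul] at e2
          rw [if_neg (by rw [← e2]; exact mul_ne_zero hs hw), ← e1, ← e2,
            mul_div_mul_left _ _ hs]
      exact ((h1 a).div (h2 a) (by rwa [dslope_same])).congr_of_eventuallyEq h4
    · have h3 : ∀ᶠ w in 𝓝 a, D w ≠ 0 := hD.continuous.continuousAt.eventually_ne ha
      refine ((hF a).div (hD a) ha).congr_of_eventuallyEq ?_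
      filter_upwards [h3] with w hw
      simp [hw]
  · by_cases hw : D w = 0
    · simp [hw, (h w hw).1]
    · simp [hw]

theorem norm_sq_sub_sq_of_norm_eq {w : ℂ} {R : ℝ} (h : ‖w‖ = R) :
    ‖w ^ 2 - (R : ℂ) ^ 2‖ = 2 * R * |w.im| := by
  have h1 : w ^ 2 - (R : ℂ) ^ 2 = w * (w - star w) := by
    have : w * star w = (R : ℂ) ^ 2 := by rw [← h]; exact Complex.mul_conj' w
    rw [← this]; ring
  have h2 : w - star w = ((2 * w.im : ℝ) : ℂ) * Complex.I := by simpa using Complex.sub_conj w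
  rw [h1, h2, norm_mul, h]
  simp
  ring

/-- On |w| = R the factor w² - R² has modulus 2R|Im w|, exactly what is needed to cancel the loss of
control of K near the real axis. The maximum principle then bounds K inside, and Liouville
concludes. -/
theorem eq_const_of_norm_mul_im_le {K : ℂ → ℂ} (hK : Differentiable ℂ K) {C : ℝ}
    (h : ∀ w : ℂ, 1 ≤ ‖w‖ → ‖K w‖ * |w.im| ≤ C * ‖w‖) (w : ℂ) : K w = K 0 := by
  refine hK.apply_eq_apply_of_bounded ?_ w 0
  rw [isBounded_iff_forall_norm_le]
  refine ⟨4 * C, ?_⟩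
  rintro _ ⟨a, rfl⟩
  -- As R > 2|a|, the factor w² - R² has modulus at least 3R²/4 at a, so the bound on K(a) does not
  -- depend on R.
  set R : ℝ := 2 * ‖a‖ + 1 with hR
  have hR1 : 1 ≤ R := by simp [hR]
  have hR0 : 0 < R := by linarith
  have hd : Differentiable ℂ fun w : ℂ => (w ^ 2 - (R : ℂ) ^ 2) * K w := by fun_prop
  have h1 := Complex.norm_le_of_forall_mem_frontier_norm_le (U := Metric.ball (0 : ℂ) R)
    (f := fun w : ℂ => (w ^ 2 - (R : ℂ) ^ 2) * K w) (C := 2 * C * R ^ 2) (z := a)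
    Metric.isBounded_ball hd.diffContOnCl (fun z hz => by
      rw [frontier_ball _ hR0.ne', mem_sphere_zero_iff_norm] at hz
      rw [norm_mul, norm_sq_sub_sq_of_norm_eq hz]
      have := h z (by rw [hz]; exact hR1)
      rw [hz] at this
      nlinarith) (subset_closure (by simp [hR]; linarith [norm_nonneg a]))
  simp only [norm_mul] at h1
  have h2 : 3 / 4 * R ^ 2 ≤ ‖a ^ 2 - (R : ℂ) ^ 2‖ := by
    have := norm_sub_norm_le ((R : ℂ) ^ 2) (a ^ 2)
    rw [norm_sub_rev, norm_pow, norm_pow, Complex.norm_real, Real.norm_of_nonneg hR0.le] at this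
    nlinarith [norm_nonneg a]
  have h3 : 3 / 4 * R ^ 2 * ‖K a‖ ≤ 2 * C * R ^ 2 :=
    (mul_le_mul_of_nonneg_right h2 (norm_nonneg _)).trans h1
  have h4 : 3 / 4 * ‖K a‖ ≤ 2 * C := by
    refine le_of_mul_le_mul_right ?_ (show 0 < R ^ 2 by positivity)
    linarith
  linarith [norm_nonneg (K a)]

/-! ### Vanishing of the moments -/

/-- The multiplier d_k is 1 (Dirichlet) or n + 2k (Neumann). The index k = 0 is excluded from the
lower bound because of the Neumann case n = 0. -/
theorem exists_besselD_eq_powerSum (n : ℕ) (s : Bool) :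
    ∃ d : ℕ → ℂ, EntireCoeff (fun k => d k * besselCoeff n k) ∧ (∀ k, 1 ≤ k → 1 ≤ ‖d k‖) ∧
      besselD n s = powerSum (fun k => d k * besselCoeff n k) := by
  cases s
  · refine ⟨fun _ => 1, ?_, fun _ _ => by simp, by simp [besselD, besselE]⟩
    simpa using entireCoeff_bessel n
  · refine ⟨fun k => (n : ℂ) + 2 * k, (entireCoeff_bessel n).eulerCoeff n, fun k hk => ?_, rfl⟩
    have : (n : ℂ) + 2 * k = ((n + 2 * k : ℕ) : ℂ) := by push_cast; ring
    simp only [this, Complex.norm_natCast]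
    exact_mod_cast (by omega : 1 ≤ n + 2 * k)

/-- Completeness of the Fourier-Bessel systems in terms of moments: if the transform
`w ↦ ∑ m_k c_k w^k` of a moment sequence vanishes at all zeros of `E_n` (or `B_n`), and is bounded
by the norm of the radial function, then all moments vanish. -/
theorem moments_eq_zero {n : ℕ} {s : Bool} {m : ℕ → ℂ}
    (hm : Filter.Tendsto m Filter.atTop (nhds 0))
    (hzero : ∀ w, besselD n s w = 0 → powerSum (fun k => m k * besselCoeff n k) w = 0)
    {M : ℝ} (hbound : ∀ w, ‖powerSum (fun k => m k * besselCoeff n k) w‖ ≤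
      M * √(radialNormSq n w)) (k : ℕ) : m k = 0 := by
  obtain ⟨A, hA⟩ := hm.norm.bddAbove_range
  have hc : EntireCoeff fun k => m k * besselCoeff n k :=
    (entireCoeff_bessel n).mono A fun k => by
      rw [norm_mul]
      exact mul_le_mul_of_nonneg_right (hA ⟨k, rfl⟩) (norm_nonneg _)
  obtain ⟨K, hK, hFK⟩ := exists_entire_quotient hc.differentiable (differentiable_besselD n s)
    fun w hw => ⟨hzero w hw, deriv_besselD_ne_zero hw⟩
  obtain ⟨C, hC0, hC⟩ := exists_sqrt_radialNormSq_mul_im_le n s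
  have hM : 0 ≤ M := by
    have h1 := (norm_nonneg _).trans (hbound 0)
    exact nonneg_of_mul_nonneg_left h1 (Real.sqrt_pos.2 (radialNormSq_pos n 0))
  have hgrowth : ∀ w : ℂ, 1 ≤ ‖w‖ → ‖K w‖ * |w.im| ≤ (M * C) * ‖w‖ := by
    intro w hw
    by_cases hD : besselD n s w = 0
    · rw [im_eq_zero_of_besselD_eq_zero hD, abs_zero, mul_zero]; positivity
    · have h1 : ‖K w‖ * ‖besselD n s w‖ ≤ M * √(radialNormSq n w) := by
        rw [← norm_mul, ← hFK]; exact hbound w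
      refine le_of_mul_le_mul_right ?_ (norm_pos_iff.2 hD)
      calc ‖K w‖ * |w.im| * ‖besselD n s w‖ = (‖K w‖ * ‖besselD n s w‖) * |w.im| := by ring
        _ ≤ (M * √(radialNormSq n w)) * |w.im| := by gcongr
        _ = M * (√(radialNormSq n w) * |w.im|) := by ring
        _ ≤ M * (C * ‖w‖ * ‖besselD n s w‖) := mul_le_mul_of_nonneg_left (hC w hw) hM
        _ = _ := by ring
  have hconst := eq_const_of_norm_mul_im_le hK hgrowth
  set c := K 0
  obtain ⟨d, hdc, hd1, hd2⟩ := exists_besselD_eq_powerSum n s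
  have hmd : ∀ k, m k = c * d k := by
    intro k
    have h1 := (hc.add (hdc.mono ‖c‖ (c := fun k => -c * (d k * besselCoeff n k)) fun k => by
      rw [norm_mul, norm_neg])).eq_zero (fun w => by
        rw [powerSum_add hc (hdc.mono ‖c‖ fun k => by rw [norm_mul, norm_neg]),
          powerSum_const_mul, ← hd2, hFK, hconst]
        ring) k
    have h2 : (m k - c * d k) * besselCoeff n k = 0 := by linear_combination h1
    exact sub_eq_zero.1 ((mul_eq_zero.1 h2).resolve_right (besselCoeff_ne_zero n k))
  -- For k ≥ 1, |c| ≤ |c d_k| = |m_k|, which tends to 0.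
  have hc0 : ‖c‖ ≤ 0 := by
    refine ge_of_tendsto (by simpa using hm.norm) ?_
    filter_upwards [Filter.eventually_ge_atTop 1] with k hk
    rw [hmd, norm_mul]
    exact le_mul_of_one_le_right (norm_nonneg _) (hd1 k hk)
  rw [hmd, norm_le_zero_iff.1 hc0, zero_mul]

/-! ### Measures on the closed unit disc are determined by their moments -/

/-- The functional `g ↦ ∫ g(T x) f(x) dμ` on continuous functions on the closed unit disc. -/
noncomputable def discFunctional {X : Type*} [MeasurableSpace X] (μ : Measure X) {T : X → ℂ}
    (hT : Measurable T) (hT1 : ∀ x, T x ∈ Metric.closedBall (0 : ℂ) 1) {f : X → ℂ}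
    (hf : Integrable f μ) : C(Metric.closedBall (0 : ℂ) 1, ℂ) →L[ℂ] ℂ :=
  have hi : ∀ g : C(Metric.closedBall (0 : ℂ) 1, ℂ),
      Integrable (fun x => g ⟨T x, hT1 x⟩ * f x) μ := fun g =>
    hf.bdd_mul (c := ‖g‖) (g.continuous.measurable.comp (hT.subtype_mk)).aestronglyMeasurable
      (ae_of_all _ fun _ => g.norm_coe_le_norm _)
  LinearMap.mkContinuous
    { toFun := fun g => ∫ x, g ⟨T x, hT1 x⟩ * f x ∂μ
      map_add' := fun g h => by
        rw [← integral_add (hi g) (hi h)]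
        exact integral_congr_ae (ae_of_all _ fun x => by simp [add_mul])
      map_smul' := fun c g => by
        rw [RingHom.id_apply, smul_eq_mul, ← integral_const_mul]
        exact integral_congr_ae (ae_of_all _ fun x => by simp [mul_assoc]) }
    (∫ x, ‖f x‖ ∂μ) (fun g => by
      rw [mul_comm, ← integral_const_mul]
      refine norm_integral_le_of_norm_le (hf.norm.const_mul _) (ae_of_all _ fun x => ?_)
      rw [norm_mul]
      exact mul_le_mul_of_nonneg_right (g.norm_coe_le_norm _) (norm_nonneg _))

theorem continuousLinearMap_eq_zero_of_moments
    (L : C(Metric.closedBall (0 : ℂ) 1, ℂ) →L[ℂ] ℂ)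
    (h : ∀ a b : ℕ, L ((ContinuousMap.id ℂ).restrict _ ^ a *
      star ((ContinuousMap.id ℂ).restrict _) ^ b) = 0) (g : C(Metric.closedBall (0 : ℂ) 1, ℂ)) :
    L g = 0 := by
  set Z : C(Metric.closedBall (0 : ℂ) 1, ℂ) := (ContinuousMap.id ℂ).restrict _ with hZ
  -- The claim is strengthened by an auxiliary factor h so that it passes to products in the
  -- Stone-Weierstrass induction.
  have key : ∀ h : C(Metric.closedBall (0 : ℂ) 1, ℂ), (∀ a b : ℕ, L (h * (Z ^ a * star Z ^ b)) = 0) →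
      ∀ a b : ℕ, L (g * h * (Z ^ a * star Z ^ b)) = 0 := by
    refine ContinuousMap.induction_on_of_compact (p := fun g => ∀ h, (∀ a b : ℕ,
      L (h * (Z ^ a * star Z ^ b)) = 0) → ∀ a b : ℕ, L (g * h * (Z ^ a * star Z ^ b)) = 0)
      ?_ ?_ ?_ ?_ ?_ ?_ g
    · intro c h hh a b
      have : ContinuousMap.const _ c * h * (Z ^ a * star Z ^ b) = c • (h * (Z ^ a * star Z ^ b)) := by
        ext x; simp [mul_assoc]
      rw [this, map_smul, hh, smul_zero]
    · intro h hh a b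
      rw [← hZ, show Z * h * (Z ^ a * star Z ^ b) = h * (Z ^ (a + 1) * star Z ^ b) by ring, hh]
    · intro h hh a b
      rw [← hZ, show star Z * h * (Z ^ a * star Z ^ b) = h * (Z ^ a * star Z ^ (b + 1)) by ring, hh]
    · intro f g hf hg h hh a b
      rw [add_mul, add_mul, map_add, hf h hh, hg h hh, add_zero]
    · intro f g hf hg h hh a b
      rw [mul_assoc f g h]
      exact hf _ (hg h hh) a b
    · intro f hf h hh a b
      have hcl : IsClosed {g : C(Metric.closedBall (0 : ℂ) 1, ℂ) |
          L (g * h * (Z ^ a * star Z ^ b)) = 0} :=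
        isClosed_eq (by fun_prop) continuous_const
      exact hcl.closure_subset (mem_closure_iff_frequently.2 (hf.mono fun g hg => hg h hh a b))
  have := key 1 (fun a b => by rw [one_mul]; exact h a b) 0 0
  simpa using this

theorem integral_comp_mul_eq_zero {X : Type*} [MeasurableSpace X] {μ : Measure X} {T : X → ℂ}
    (hT : Measurable T) (hT1 : ∀ x, T x ∈ Metric.closedBall (0 : ℂ) 1) {f : X → ℂ}
    (hf : Integrable f μ) (h : ∀ a b : ℕ, ∫ x, T x ^ a * star (T x) ^ b * f x ∂μ = 0)
    {g : ℂ → ℂ} (hg : Continuous g) : ∫ x, g (T x) * f x ∂μ = 0 :=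
  continuousLinearMap_eq_zero_of_moments (discFunctional μ hT hT1 hf)
    (fun a b => h a b) ⟨fun z => g z, by fun_prop⟩

/-- The retraction of the plane to the closed unit disc by reflection in the unit circle. -/
noncomputable def discReflect (z : ℂ) : ℂ := if ‖z‖ ≤ 1 then z else (star z)⁻¹

theorem measurableSet_disc : MeasurableSet {z : ℂ | ‖z‖ ≤ 1} :=
  measurableSet_le measurable_norm measurable_const

theorem measurable_discReflect : Measurable discReflect :=
  Measurable.ite measurableSet_disc measurable_id
    (continuous_star.measurable.inv)

theorem norm_discReflect_le (z : ℂ) : ‖discReflect z‖ ≤ 1 := by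
  rw [discReflect]
  split_ifs with h
  · exact h
  · rw [norm_inv, norm_star]; exact inv_le_one_of_one_le₀ (not_le.1 h).le

theorem exists_forall_eq_zero_of_norm_inv {g : ℂ → ℂ} (hs : HasCompactSupport g) :
    ∃ ε > 0, ∀ u v : ℂ, ‖u‖ < ε → u ≠ 0 → ‖v‖ = ‖u‖⁻¹ → g v = 0 := by
  obtain ⟨R, hR0, hR⟩ := hs.isCompact.isBounded.exists_pos_norm_le
  refine ⟨R⁻¹, inv_pos.2 hR0, fun u v hu hu0 hv => ?_⟩
  by_contra hne
  have h1 := hR v (subset_tsupport g (Function.mem_support.2 hne))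
  rw [hv] at h1
  exact absurd h1 (not_le.2 ((lt_inv_comm₀ (norm_pos_iff.2 hu0) hR0).1 hu))

/-- Makes a test function outside the disc a continuous function of the reflected point; compact
support gives continuity at u = 0, the image of infinity. -/
theorem continuous_comp_inv_star {g : ℂ → ℂ} (hg : Continuous g) (hs : HasCompactSupport g) :
    Continuous fun u : ℂ => if u = 0 then 0 else g (star u)⁻¹ := by
  obtain ⟨R, hR0, hR⟩ := exists_forall_eq_zero_of_norm_inv hs
  rw [continuous_iff_continuousAt]
  intro u
  rcases eq_or_ne u 0 with rfl | hu
  · refine (continuousAt_const (y := (0 : ℂ))).congr ?_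
    filter_upwards [Metric.ball_mem_nhds (0 : ℂ) hR0] with v hv
    split_ifs with h
    · rfl
    · exact (hR v _ (by simpa using hv) h (by rw [norm_inv, norm_star])).symm
  · have : ContinuousAt (fun u : ℂ => g (star u)⁻¹) u :=
      hg.continuousAt.comp (continuous_star.continuousAt.inv₀ (star_ne_zero.2 hu))
    refine this.congr ?_
    filter_upwards [isOpen_ne.mem_nhds hu] with v hv
    exact (if_neg hv).symm

theorem ae_eq_zero_of_disc_moments {f : ℂ → ℂ} (hf : Integrable f omegaInfty)
    (hin : ∀ a b : ℕ, ∫ z in {z : ℂ | ‖z‖ ≤ 1},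
      discReflect z ^ a * star (discReflect z) ^ b * f z ∂omegaInfty = 0)
    (hout : ∀ a b : ℕ, ∫ z in {z : ℂ | ‖z‖ ≤ 1}ᶜ,
      discReflect z ^ a * star (discReflect z) ^ b * f z ∂omegaInfty = 0) :
    f =ᵐ[omegaInfty] 0 := by
  refine ae_eq_zero_of_integral_contDiff_smul_eq_zero hf.locallyIntegrable fun g hg hgs => ?_
  have hT1 : ∀ z, discReflect z ∈ Metric.closedBall (0 : ℂ) 1 := fun z => by
    simpa using norm_discReflect_le z
  have hgc : Continuous fun z => (g z : ℂ) := Complex.continuous_ofReal.comp hg.continuous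
  have hgs' : HasCompactSupport fun z => (g z : ℂ) :=
    hgs.comp_left (g := Complex.ofReal) Complex.ofReal_zero
  have h1 := integral_comp_mul_eq_zero measurable_discReflect hT1 hf.integrableOn hin hgc
  have h2 := integral_comp_mul_eq_zero measurable_discReflect hT1 hf.integrableOn hout
    (continuous_comp_inv_star hgc hgs')
  have e1 : ∫ z in {z : ℂ | ‖z‖ ≤ 1}, g z • f z ∂omegaInfty = 0 := by
    rw [← h1]
    refine setIntegral_congr_fun measurableSet_disc fun z hz => ?_
    simp only [discReflect, if_pos (show ‖z‖ ≤ 1 from hz)]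
    exact Complex.real_smul
  have e2 : ∫ z in {z : ℂ | ‖z‖ ≤ 1}ᶜ, g z • f z ∂omegaInfty = 0 := by
    rw [← h2]
    refine setIntegral_congr_fun measurableSet_disc.compl fun z hz => ?_
    have hz' : ¬ ‖z‖ ≤ 1 := hz
    have hz0 : z ≠ 0 := by rintro rfl; simp at hz'
    have e : (star z)⁻¹ ≠ 0 := inv_ne_zero (star_ne_zero.2 hz0)
    simp only [discReflect, if_neg hz', if_neg e, star_inv₀, star_star, inv_inv]
    exact Complex.real_smul
  have hi : Integrable (fun z => g z • f z) omegaInfty := by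
    obtain ⟨C, hC⟩ := hgs'.exists_bound_of_continuous hgc
    exact (hf.bdd_mul (c := C) hgc.aestronglyMeasurable (ae_of_all _ hC)).congr
      (ae_of_all _ fun z => Complex.real_smul.symm)
  rw [← integral_add_compl measurableSet_disc hi, e1, e2, add_zero]

/-! ### Smooth functions on the sphere are dense -/

theorem isSmoothOnSphere_extend {g : ℂ → ℂ} (hg : ContDiff ℝ ∞ g) (hs : HasCompactSupport g) :
    IsSmoothOnSphere (fun x : OnePoint ℂ => x.elim 0 g) := by
  refine ⟨hg, ?_⟩
  obtain ⟨R, hR0, hR⟩ := exists_forall_eq_zero_of_norm_inv hs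
  have e : (fun w : ℂ => (chartInfty w).elim 0 g) = fun w : ℂ => if w = 0 then 0 else g w⁻¹ := by
    funext w
    unfold chartInfty
    split_ifs <;> rfl
  rw [e, contDiff_iff_contDiffAt]
  intro u
  rcases eq_or_ne u 0 with rfl | hu
  · refine (contDiffAt_const (c := (0 : ℂ))).congr_of_eventuallyEq ?_
    filter_upwards [Metric.ball_mem_nhds (0 : ℂ) hR0] with v hv
    split_ifs with h
    · rfl
    · exact hR v _ (by simpa using hv) h (norm_inv v)
  · have h1 : ContDiffAt ℝ ∞ (fun u : ℂ => u⁻¹) u := (contDiffAt_inv ℂ hu).restrict_scalars ℝ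
    refine (hg.contDiffAt.comp u h1).congr_of_eventuallyEq ?_
    filter_upwards [isOpen_ne.mem_nhds hu] with v hv
    exact if_neg hv

/-- Compactly supported smooth functions extend by 0 to the sphere, so a vector orthogonal to all
smooth classes integrates to 0 against every such test function. -/
theorem H0_eq_top : H0 = ⊤ := by
  rw [H0, Submodule.topologicalClosure_eq_top_iff, Submodule.eq_bot_iff]
  intro f hf
  have hfi : Integrable (f : ℂ → ℂ) omegaInfty := (Lp.memLp f).integrable one_le_two
  refine Lp.eq_zero_iff_ae_eq_zero.2
    (ae_eq_zero_of_integral_contDiff_smul_eq_zero hfi.locallyIntegrable fun g hg hgs => ?_)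
  have hgc : ContDiff ℝ ∞ fun z => (g z : ℂ) := Complex.ofRealCLM.contDiff.comp hg
  have hsm := isSmoothOnSphere_extend hgc
    (hgs.comp_left (g := Complex.ofReal) Complex.ofReal_zero)
  have h1 := (Submodule.mem_orthogonal _ _).1 hf (hsm.memLp.toLp _)
    ⟨_, hsm, hsm.memLp.coeFn_toLp⟩
  rw [L2.inner_def] at h1
  rw [← h1]
  refine integral_congr_ae ?_
  filter_upwards [hsm.memLp.coeFn_toLp] with z hz
  rw [hz]
  simp [RCLike.inner_apply, mul_comm]

/-! ### Integration in polar coordinates -/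

/-- The distance to the origin after reflection to the unit disc. -/
noncomputable def rho (z : ℂ) : ℝ := if ‖z‖ ≤ 1 then ‖z‖ else ‖z‖⁻¹

/-- The locally constant function off the unit circle which is `1` outside the disc, and `1` or
`-1` inside. -/
noncomputable def sideSign (s : Bool) (z : ℂ) : ℂ := if ‖z‖ ≤ 1 then (if s then 1 else -1) else 1

/-- The function `e^{iνθ}`. -/
noncomputable def angular (ν : ℤ) (z : ℂ) : ℂ := Complex.exp (Complex.I * ν * Complex.arg z)

theorem rho_nonneg (z : ℂ) : 0 ≤ rho z := by
  rw [rho]; split_ifs <;> positivity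

theorem rho_le_one (z : ℂ) : rho z ≤ 1 := by
  rw [rho]
  split_ifs with h
  · exact h
  · exact inv_le_one_of_one_le₀ (not_le.1 h).le

theorem measurable_rho : Measurable rho :=
  Measurable.ite measurableSet_disc measurable_norm measurable_norm.inv

theorem measurable_sideSign (s : Bool) : Measurable (sideSign s) :=
  Measurable.ite measurableSet_disc measurable_const measurable_const

theorem measurable_angular (ν : ℤ) : Measurable (angular ν) := by
  unfold angular
  exact Complex.measurable_exp.comp
    ((Complex.measurable_ofReal.comp Complex.measurable_arg).const_mul _)

theorem norm_sideSign (s : Bool) (z : ℂ) : ‖sideSign s z‖ = 1 := by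
  rw [sideSign]; cases s <;> split_ifs <;> simp_all

theorem norm_angular (ν : ℤ) (z : ℂ) : ‖angular ν z‖ = 1 := by
  rw [angular, show Complex.I * ν * Complex.arg z = ((ν * Complex.arg z : ℝ) : ℂ) * Complex.I by
    push_cast; ring, Complex.norm_exp_ofReal_mul_I]

theorem star_angular (ν : ℤ) (z : ℂ) : star (angular ν z) = angular (-ν) z := by
  simp only [angular, Complex.star_def, ← Complex.exp_conj]
  congr 1
  simp

theorem angular_mul (ν μ : ℤ) (z : ℂ) : angular ν z * angular μ z = angular (ν + μ) z := by
  rw [angular, angular, angular, ← Complex.exp_add]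
  congr 1
  push_cast; ring

theorem integral_exp_int_mul (m : ℤ) :
    ∫ θ in Set.Ioo (-Real.pi) Real.pi, Complex.exp (Complex.I * m * θ) =
      if m = 0 then 2 * (Real.pi : ℂ) else 0 := by
  rw [← integral_Ioc_eq_integral_Ioo,
    ← intervalIntegral.integral_of_le (by linarith [Real.pi_pos])]
  split_ifs with h
  · subst h; simp; ring
  · rw [integral_exp_mul_complex (mul_ne_zero Complex.I_ne_zero (by exact_mod_cast h))]
    have : Complex.exp (Complex.I * m * (Real.pi : ℝ)) =
        Complex.exp (Complex.I * m * ((-Real.pi : ℝ) : ℂ)) := by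
      rw [Complex.exp_eq_exp_iff_exists_int]
      exact ⟨m, by push_cast; ring⟩
    rw [this, sub_self, zero_div]

theorem integral_omegaInfty_polar (H : ℝ → ℂ) (m : ℤ) :
    ∫ z, H ‖z‖ * angular m z ∂omegaInfty =
      (∫ r in Set.Ioi (0 : ℝ), ((r / (Real.pi * (max 1 (r ^ 2)) ^ 2) : ℝ) : ℂ) * H r) *
        ∫ θ in Set.Ioo (-Real.pi) Real.pi, Complex.exp (Complex.I * m * θ) := by
  rw [omegaInfty, integral_withDensity_eq_integral_toReal_smul (by fun_prop)
    (ae_of_all _ fun _ => ENNReal.ofReal_lt_top), ← Complex.integral_comp_polarCoord_symm,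
    polarCoord_target, ← setIntegral_prod_mul, ← Measure.volume_eq_prod]
  refine setIntegral_congr_fun (measurableSet_Ioi.prod measurableSet_Ioo) ?_
  rintro ⟨r, θ⟩ ⟨hr, hθ⟩
  have hr0 : 0 < r := hr
  have hn : ‖Complex.polarCoord.symm (r, θ)‖ = r := by
    rw [Complex.norm_polarCoord_symm]; exact abs_of_pos hr0
  have ha : Complex.arg (Complex.polarCoord.symm (r, θ)) = θ := by
    rw [Complex.polarCoord_symm_apply]
    have := Complex.arg_mul_cos_add_sin_mul_I hr0 ⟨hθ.1, hθ.2.le⟩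
    push_cast
    exact this
  simp only [hn, angular, ha]
  rw [ENNReal.toReal_ofReal (by positivity), Complex.real_smul, Complex.real_smul]
  push_cast
  ring

/-- The substitution r ↦ 1/r carries the density r/r⁴ on r > 1 to r on r < 1, so the two hemispheres
carry the same measure. -/
theorem integral_radial_density {g₁ g₂ : ℝ → ℂ} (h₁ : Continuous g₁) (h₂ : Continuous g₂) :
    ∫ r in Set.Ioi (0 : ℝ), ((r / (Real.pi * (max 1 (r ^ 2)) ^ 2) : ℝ) : ℂ) *
        (if r ≤ 1 then g₁ r else g₂ r⁻¹) =
      (Real.pi : ℂ)⁻¹ * ∫ r in (0 : ℝ)..1, (r : ℂ) * (g₁ r + g₂ r) := by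
  set G : ℝ → ℂ := fun r => ((r / (Real.pi * (max 1 (r ^ 2)) ^ 2) : ℝ) : ℂ) *
        (if r ≤ 1 then g₁ r else g₂ r⁻¹)
  have hpi : (Real.pi : ℂ) ≠ 0 := by exact_mod_cast Real.pi_ne_zero
  have c1 : Continuous fun r : ℝ => (Real.pi : ℂ)⁻¹ * ((r : ℂ) * g₁ r) := by fun_prop
  have c2 : Continuous fun r : ℝ => (Real.pi : ℂ)⁻¹ * ((r : ℂ) * g₂ r) := by fun_prop
  have e1 : Set.EqOn G (fun r => (Real.pi : ℂ)⁻¹ * ((r : ℂ) * g₁ r)) (Set.Ioc 0 1) := by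
    intro r hr
    have : max 1 (r ^ 2) = 1 := max_eq_left (pow_le_one₀ hr.1.le hr.2)
    simp only [G, this, if_pos hr.2]
    push_cast
    field_simp
  -- Cutting off at 1 lets the substitution be made on the whole half-line, where the change of
  -- variables for real powers applies with exponent -1.
  set K : ℝ → ℂ := (Set.Iio 1).indicator fun r => (Real.pi : ℂ)⁻¹ * ((r : ℂ) * g₂ r)
  have e2 : Set.EqOn (fun r => (|(-1 : ℝ)| * r ^ ((-1 : ℝ) - 1)) • K (r ^ (-1 : ℝ)))
      ((Set.Ioi 1).indicator G) (Set.Ioi 0) := by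
    intro r hr
    have hr0 : (0 : ℝ) < r := hr
    have hr1 : (r : ℂ) ≠ 0 := by exact_mod_cast hr0.ne'
    have e : r ^ ((-1 : ℝ) - 1) = (r ^ 2)⁻¹ := by
      rw [show (-1 : ℝ) - 1 = -(2 : ℕ) by norm_num, Real.rpow_neg hr0.le, Real.rpow_natCast]
    simp only [e, Real.rpow_neg_one, K]
    by_cases h : 1 < r
    · have hm : max 1 (r ^ 2) = r ^ 2 := max_eq_right (one_le_pow₀ h.le)
      rw [Set.indicator_of_mem (show r⁻¹ ∈ Set.Iio 1 from inv_lt_one_of_one_lt₀ h),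
        Set.indicator_of_mem (show r ∈ Set.Ioi 1 from h)]
      simp only [G, hm, if_neg (not_le.2 h), Complex.real_smul]
      push_cast
      simp
      field_simp
    · rw [Set.indicator_of_notMem (show r⁻¹ ∉ Set.Iio 1 from
          not_lt.2 ((one_le_inv₀ hr0).2 (not_lt.1 h))),
        Set.indicator_of_notMem (show r ∉ Set.Ioi 1 from h), smul_zero]
  have k1 : IntegrableOn K (Set.Ioi 0) := by
    have : IntegrableOn (fun r : ℝ => (Real.pi : ℂ)⁻¹ * ((r : ℂ) * g₂ r)) (Set.Ioo 0 1) :=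
      (c2.integrableOn_Icc (a := 0) (b := 1)).mono_set Set.Ioo_subset_Icc_self
    rw [IntegrableOn, integrable_indicator_iff measurableSet_Iio, IntegrableOn,
      Measure.restrict_restrict measurableSet_Iio]
    rwa [Set.Iio_inter_Ioi]
  have k2 : ∫ r in Set.Ioi (0 : ℝ), K r = (Real.pi : ℂ)⁻¹ * ∫ r in (0 : ℝ)..1, (r : ℂ) * g₂ r := by
    rw [setIntegral_indicator measurableSet_Iio, Set.Ioi_inter_Iio,
      ← integral_Ioc_eq_integral_Ioo, ← intervalIntegral.integral_of_le zero_le_one,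
      intervalIntegral.integral_const_mul]
  have g1 : IntegrableOn G (Set.Ioc 0 1) :=
    ((c1.integrableOn_Icc (a := 0) (b := 1)).mono_set Set.Ioc_subset_Icc_self).congr_fun
      e1.symm measurableSet_Ioc
  have hsub : Set.Ioi (1 : ℝ) ⊆ Set.Ioi 0 := Set.Ioi_subset_Ioi zero_le_one
  have g2 : IntegrableOn G (Set.Ioi 1) := by
    have := ((integrableOn_Ioi_comp_rpow_iff K (p := -1) (by norm_num)).2 k1).congr_fun e2
      measurableSet_Ioi
    rw [IntegrableOn, integrable_indicator_iff measurableSet_Ioi, IntegrableOn,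
      Measure.restrict_restrict measurableSet_Ioi] at this
    rwa [Set.inter_eq_left.2 hsub] at this
  have g3 : ∫ r in Set.Ioi (1 : ℝ), G r = ∫ r in Set.Ioi (0 : ℝ), K r := by
    rw [← integral_comp_rpow_Ioi K (p := -1) (by norm_num),
      setIntegral_congr_fun measurableSet_Ioi e2, setIntegral_indicator measurableSet_Ioi,
      Set.inter_eq_right.2 hsub]
  rw [← Set.Ioc_union_Ioi_eq_Ioi (zero_le_one (α := ℝ)),
    setIntegral_union (Set.Ioc_disjoint_Ioi le_rfl) measurableSet_Ioi g1 g2, g3, k2,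
    setIntegral_congr_fun measurableSet_Ioc e1, ← intervalIntegral.integral_of_le zero_le_one,
    intervalIntegral.integral_const_mul, ← mul_add, ← intervalIntegral.integral_add
      (Continuous.intervalIntegrable (by fun_prop) _ _)
      (Continuous.intervalIntegrable (by fun_prop) _ _)]
  simp only [mul_add]

theorem integral_omegaInfty_rho {g₁ g₂ : ℝ → ℂ} (h₁ : Continuous g₁) (h₂ : Continuous g₂)
    (m : ℤ) :
    ∫ z, (if ‖z‖ ≤ 1 then g₁ (rho z) else g₂ (rho z)) * angular m z ∂omegaInfty =
      if m = 0 then 2 * ∫ r in (0 : ℝ)..1, (r : ℂ) * (g₁ r + g₂ r) else 0 := by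
  have e : ∀ z : ℂ, (if ‖z‖ ≤ 1 then g₁ (rho z) else g₂ (rho z)) =
      (fun r : ℝ => if r ≤ 1 then g₁ r else g₂ r⁻¹) ‖z‖ := by
    intro z
    simp only [rho]
    split_ifs <;> rfl
  simp only [e]
  rw [integral_omegaInfty_polar (fun r : ℝ => if r ≤ 1 then g₁ r else g₂ r⁻¹),
    integral_radial_density h₁ h₂, integral_exp_int_mul]
  have hpi : (Real.pi : ℂ) ≠ 0 := by exact_mod_cast Real.pi_ne_zero
  split_ifs
  · field_simp
  · simp

/-! ### The eigenfunctions -/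

/-- The eigenfunction with radial part `r^{|ν|} E_{|ν|}(w r²)`, even (`true`) or odd (`false`) under
reflection in the unit circle. -/
noncomputable def psi (ν : ℤ) (s : Bool) (w : ℂ) (z : ℂ) : ℂ :=
  sideSign s z * radial ν.natAbs w (rho z) * angular ν z

theorem measurable_psi (ν : ℤ) (s : Bool) (w : ℂ) : Measurable (psi ν s w) :=
  ((measurable_sideSign s).mul
    ((continuous_radial ν.natAbs w).measurable.comp measurable_rho)).mul (measurable_angular ν)

theorem memLp_psi (ν : ℤ) (s : Bool) (w : ℂ) : MemLp (psi ν s w) 2 omegaInfty := by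
  obtain ⟨C, hC⟩ := (isCompact_Icc (a := (0 : ℝ)) (b := 1)).exists_bound_of_continuousOn
    (continuous_radial ν.natAbs w).continuousOn
  refine MemLp.of_bound (measurable_psi ν s w).aestronglyMeasurable C (ae_of_all _ fun z => ?_)
  rw [psi, norm_mul, norm_mul, norm_sideSign, norm_angular, one_mul, mul_one]
  exact hC _ ⟨rho_nonneg z, rho_le_one z⟩

theorem star_psi (ν : ℤ) (s : Bool) (w : ℂ) (z : ℂ) :
    star (psi ν s w z) = psi (-ν) s (star w) z := by
  have : star (sideSign s z) = sideSign s z := by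
    rw [sideSign]; cases s <;> split_ifs <;> simp_all
  rw [psi, psi, star_mul', star_mul', this, star_angular, radial_conj, Int.natAbs_neg]

/-- Opposite parities cancel between the two sides of the circle; equal parities double the radial
integral, and the angular integration contributes the other factor 2. -/
theorem integral_psi_mul_psi (ν ν' : ℤ) (s s' : Bool) (w w' : ℂ) :
    ∫ z, psi ν s w z * psi ν' s' w' z ∂omegaInfty =
      if ν + ν' = 0 ∧ s = s' then
        4 * ∫ r in (0 : ℝ)..1, (r : ℂ) * (radial ν.natAbs w r * radial ν'.natAbs w' r)
      else 0 := by
  have c : Continuous fun r => radial ν.natAbs w r * radial ν'.natAbs w' r :=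
    (continuous_radial _ _).mul (continuous_radial _ _)
  have h := integral_omegaInfty_rho
    (c.const_mul (if s = s' then 1 else -1)) c (ν + ν')
  have e : ∀ z, psi ν s w z * psi ν' s' w' z =
      (if ‖z‖ ≤ 1 then (if s = s' then 1 else -1) *
        (radial ν.natAbs w (rho z) * radial ν'.natAbs w' (rho z)) else
        radial ν.natAbs w (rho z) * radial ν'.natAbs w' (rho z)) * angular (ν + ν') z := by
    intro z
    rw [← angular_mul, psi, psi, sideSign, sideSign]
    cases s <;> cases s' <;> split_ifs <;> simp_all <;> ring
  simp only [e]
  rw [h]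
  by_cases h1 : ν + ν' = 0 <;> by_cases h2 : s = s' <;> simp only [h1, h2, if_true, if_false,
    and_self, false_and, and_false]
  · have : ∀ x : ℂ, 1 * x + x = 2 * x := fun x => by ring
    simp only [this, mul_left_comm _ (2 : ℂ)]
    rw [intervalIntegral.integral_const_mul]
    ring
  · simp

theorem inner_psi_toLp (ν : ℤ) (s : Bool) (w : ℂ) (f : Lp ℂ 2 omegaInfty) :
    inner ℂ ((memLp_psi ν s w).toLp _) f = ∫ z, psi (-ν) s (star w) z * f z ∂omegaInfty := by
  rw [L2.inner_def]
  refine integral_congr_ae ?_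
  filter_upwards [(memLp_psi ν s w).coeFn_toLp] with z hz
  rw [hz, RCLike.inner_apply, ← star_psi, mul_comm]
  rfl

theorem inner_psi_psi (ν ν' : ℤ) (s s' : Bool) (w w' : ℂ) :
    inner ℂ ((memLp_psi ν s w).toLp _) ((memLp_psi ν' s' w').toLp _) =
      if -ν + ν' = 0 ∧ s = s' then
        4 * ∫ r in (0 : ℝ)..1, (r : ℂ) * (radial ν.natAbs (star w) r * radial ν'.natAbs w' r)
      else 0 := by
  rw [inner_psi_toLp, ← Int.natAbs_neg ν, ← integral_psi_mul_psi]
  refine integral_congr_ae ?_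
  filter_upwards [(memLp_psi ν' s' w').coeFn_toLp] with z hz
  rw [hz]

theorem norm_psi_toLp (ν : ℤ) (s : Bool) (w : ℂ) :
    ‖(memLp_psi ν s w).toLp _‖ = 2 * √(radialNormSq ν.natAbs w) := by
  have h := inner_self_eq_norm_sq_to_K (𝕜 := ℂ) ((memLp_psi ν s w).toLp _)
  rw [inner_psi_psi] at h
  simp only [neg_add_cancel, and_self, if_true, radial_conj, mul_comm (star _)] at h
  rw [integral_radial_mul_star] at h
  have h2 : ‖(memLp_psi ν s w).toLp _‖ ^ 2 = 4 * radialNormSq ν.natAbs w := by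
    refine Complex.ofReal_injective ?_
    push_cast
    exact h.symm
  rw [← Real.sqrt_sq (norm_nonneg _), h2, Real.sqrt_mul (by norm_num),
    show (4 : ℝ) = 2 ^ 2 by norm_num, Real.sqrt_sq (by norm_num)]

theorem psi_toLp_ne_zero (ν : ℤ) (s : Bool) (w : ℂ) : (memLp_psi ν s w).toLp _ ≠ 0 := by
  rw [← norm_ne_zero_iff, norm_psi_toLp]
  exact mul_ne_zero two_ne_zero (Real.sqrt_ne_zero'.2 (radialNormSq_pos _ _))

theorem inner_psi_psi_eq_zero {ν ν' : ℤ} {s s' : Bool} {w w' : ℂ}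
    (hw : besselD ν.natAbs s w = 0) (hw' : besselD ν'.natAbs s' w' = 0)
    (hne : ν = ν' → w ≠ w') :
    inner ℂ ((memLp_psi ν s w).toLp _) ((memLp_psi ν' s' w').toLp _) = 0 := by
  rw [inner_psi_psi]
  split_ifs with h
  · obtain ⟨h1, rfl⟩ := h
    obtain rfl : ν = ν' := by omega
    rw [star_eq_of_besselD_eq_zero hw, integral_radial_orthogonal hw hw' (hne rfl), mul_zero]
  · rfl

/-! ### Completeness -/

/-- The function `± ρ^{|ν| + 2k} e^{iνθ}` whose integrals are the moments. -/
noncomputable def monomial (ν : ℤ) (s : Bool) (k : ℕ) (z : ℂ) : ℂ :=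
  sideSign s z * (rho z : ℂ) ^ (ν.natAbs + 2 * k) * angular ν z

theorem measurable_monomial (ν : ℤ) (s : Bool) (k : ℕ) : Measurable (monomial ν s k) :=
  ((measurable_sideSign s).mul ((Complex.measurable_ofReal.comp measurable_rho).pow_const _)).mul
    (measurable_angular ν)

theorem norm_monomial (ν : ℤ) (s : Bool) (k : ℕ) (z : ℂ) :
    ‖monomial ν s k z‖ = rho z ^ (ν.natAbs + 2 * k) := by
  rw [monomial, norm_mul, norm_mul, norm_sideSign, norm_angular, norm_pow, Complex.norm_real,
    Real.norm_of_nonneg (rho_nonneg z), one_mul, mul_one]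

theorem norm_monomial_le (ν : ℤ) (s : Bool) (k : ℕ) (z : ℂ) : ‖monomial ν s k z‖ ≤ 1 := by
  rw [norm_monomial]
  exact pow_le_one₀ (rho_nonneg z) (rho_le_one z)

theorem integrable_monomial_mul (ν : ℤ) (s : Bool) (k : ℕ) {f : ℂ → ℂ}
    (hf : Integrable f omegaInfty) : Integrable (fun z => monomial ν s k z * f z) omegaInfty :=
  hf.bdd_mul (c := 1) (measurable_monomial ν s k).aestronglyMeasurable
    (ae_of_all _ (norm_monomial_le ν s k))

theorem hasSum_psi (ν : ℤ) (s : Bool) (w z : ℂ) :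
    HasSum (fun k => besselCoeff ν.natAbs k * w ^ k * monomial ν s k z) (psi ν s w z) := by
  have h := (((entireCoeff_bessel ν.natAbs).summable (w * (rho z : ℂ) ^ 2)).hasSum).mul_left
    (sideSign s z * (rho z : ℂ) ^ ν.natAbs * angular ν z)
  have e1 : psi ν s w z = sideSign s z * (rho z : ℂ) ^ ν.natAbs * angular ν z *
      powerSum (besselCoeff ν.natAbs) (w * (rho z : ℂ) ^ 2) := by
    simp only [psi, radial, besselE]; ring
  rw [e1]
  refine h.congr_fun fun k => ?_
  rw [monomial, pow_add, pow_mul, mul_pow]; ring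

/-- Integrates the series of `psi` term by term: the pairing of f with the eigenfunctions is the
generating series of its moments, hence entire in w. -/
theorem powerSum_moments (ν : ℤ) (s : Bool) (w : ℂ) {f : ℂ → ℂ} (hf : Integrable f omegaInfty) :
    powerSum (fun k => (∫ z, monomial ν s k z * f z ∂omegaInfty) * besselCoeff ν.natAbs k) w =
      ∫ z, psi ν s w z * f z ∂omegaInfty := by
  have hi := fun k => (integrable_monomial_mul ν s k hf).const_mul (besselCoeff ν.natAbs k * w ^ k)
  have hs : Summable fun k => ∫ z, ‖besselCoeff ν.natAbs k * w ^ k * (monomial ν s k z * f z)‖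
      ∂omegaInfty := by
    refine Summable.of_nonneg_of_le (fun k => integral_nonneg fun z => norm_nonneg _) (fun k => ?_)
      ((entireCoeff_bessel ν.natAbs ‖w‖ (norm_nonneg w)).mul_right (∫ z, ‖f z‖ ∂omegaInfty))
    rw [← integral_const_mul]
    refine integral_mono (hi k).norm (hf.norm.const_mul _) fun z => ?_
    simp only [norm_mul, norm_pow]
    have := norm_monomial_le ν s k z
    gcongr
    exact mul_le_of_le_one_left (norm_nonneg _) this
  have h := (hasSum_integral_of_summable_integral_norm hi hs).tsum_eq
  rw [powerSum]
  convert h using 1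
  · refine tsum_congr fun k => ?_
    rw [integral_const_mul]; ring
  · refine integral_congr_ae (ae_of_all _ fun z => ?_)
    have := ((hasSum_psi ν s w z).mul_right (f z)).tsum_eq
    simp only [← this, mul_assoc]

theorem ae_rho_lt_one : ∀ᵐ z ∂omegaInfty, rho z < 1 := by
  have h1 : omegaInfty (Metric.sphere (0 : ℂ) 1) = 0 :=
    withDensity_absolutelyContinuous _ _ (Measure.addHaar_sphere _ _ _)
  filter_upwards [measure_eq_zero_iff_ae_notMem.1 h1] with z hz
  have hz' : ‖z‖ ≠ 1 := by simpa using hz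
  rw [rho]
  split_ifs with h
  · exact lt_of_le_of_ne h hz'
  · exact inv_lt_one_of_one_lt₀ (not_le.1 h)

-- Dominated convergence: ρ^(n+2k) → 0 off the unit circle, which is a null set.
open Filter Topology in
theorem tendsto_moments (ν : ℤ) (s : Bool) {f : ℂ → ℂ} (hf : Integrable f omegaInfty) :
    Tendsto (fun k => ∫ z, monomial ν s k z * f z ∂omegaInfty) atTop (𝓝 0) := by
  rw [← integral_zero ℂ ℂ (μ := omegaInfty)]
  refine tendsto_integral_of_dominated_convergence (fun z => ‖f z‖)
    (fun k => (integrable_monomial_mul ν s k hf).aestronglyMeasurable) hf.norm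
    (fun k => ae_of_all _ fun z => ?_) ?_
  · rw [norm_mul]
    exact mul_le_of_le_one_left (norm_nonneg _) (norm_monomial_le ν s k z)
  · filter_upwards [ae_rho_lt_one] with z hz
    rw [← zero_mul (f z)]
    refine Tendsto.mul_const _ (tendsto_zero_iff_norm_tendsto_zero.2 ?_)
    simp only [norm_monomial]
    refine (tendsto_pow_atTop_nhds_zero_of_lt_one (rho_nonneg z) hz).comp
      (tendsto_atTop_mono (fun k => ?_) tendsto_id)
    simp only [id]
    omega

theorem moments_eq_zero_of_inner_psi {f : Lp ℂ 2 omegaInfty}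
    (h : ∀ (ν : ℤ) (s : Bool) (w : ℂ), besselD ν.natAbs s w = 0 →
      inner ℂ ((memLp_psi ν s w).toLp _) f = 0) (ν : ℤ) (s : Bool) (k : ℕ) :
    ∫ z, monomial ν s k z * f z ∂omegaInfty = 0 := by
  have hf : Integrable (f : ℂ → ℂ) omegaInfty := (Lp.memLp f).integrable one_le_two
  -- The inner product conjugates its first argument, which replaces ν by -ν and w by its conjugate;
  -- at zeros w is real and |-ν| = |ν|.
  have hinner : ∀ w, ∫ z, psi ν s w z * f z ∂omegaInfty =
      inner ℂ ((memLp_psi (-ν) s (star w)).toLp _) f := fun w => by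
    rw [inner_psi_toLp, neg_neg, star_star]
  refine moments_eq_zero (n := ν.natAbs) (s := s) (tendsto_moments ν s hf) (fun w hw => ?_)
    (M := 2 * ‖f‖) (fun w => ?_) k
  · rw [powerSum_moments ν s w hf, hinner]
    refine h _ _ _ ?_
    rwa [Int.natAbs_neg, star_eq_of_besselD_eq_zero hw]
  · rw [powerSum_moments ν s w hf, hinner]
    refine (norm_inner_le_norm _ _).trans ?_
    have : radialNormSq ν.natAbs (star w) = radialNormSq ν.natAbs w := by
      simp only [radialNormSq, radial_conj, norm_star]
    rw [norm_psi_toLp, Int.natAbs_neg, this]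
    exact le_of_eq (by ring)

theorem discReflect_eq (z : ℂ) :
    discReflect z = (rho z : ℂ) * Complex.exp (Complex.I * Complex.arg z) := by
  have h := Complex.norm_mul_exp_arg_mul_I z
  rw [mul_comm (Complex.arg z : ℂ)] at h
  rw [discReflect, rho]
  split_ifs with hz
  · exact h.symm
  · have hz0 : z ≠ 0 := by rintro rfl; simp at hz
    have hn : (‖z‖ : ℂ) ≠ 0 := by exact_mod_cast norm_ne_zero_iff.2 hz0
    have h1 : z * star z = (‖z‖ : ℂ) ^ 2 := Complex.mul_conj' z
    rw [Complex.ofReal_inv]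
    have h2 : Complex.exp (Complex.I * Complex.arg z) = z / ‖z‖ := by
      rw [eq_div_iff hn, mul_comm]; exact h
    refine inv_eq_of_mul_eq_one_right ?_
    rw [h2]
    field_simp
    rw [mul_comm, h1]

/-- On the disc, z^a z̄^b is the monomial with ν = a - b and k = min(a, b), since |a - b| + 2 min(a,
b) = a + b. Hence the moments for all ν and k cover all polynomials in z and z̄. -/
theorem discReflect_pow_mul (a b : ℕ) (z : ℂ) :
    discReflect z ^ a * star (discReflect z) ^ b =
      (rho z : ℂ) ^ (((a : ℤ) - b).natAbs + 2 * min a b) * angular (a - b) z := by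
  have e1 : ((a : ℤ) - b).natAbs + 2 * min a b = a + b := by omega
  have e2 : Complex.exp (Complex.I * Complex.arg z) = angular 1 z := by simp [angular]
  have e3 : ∀ (ν : ℤ) (n : ℕ), angular ν z ^ n = angular (n * ν) z := fun ν n => by
    rw [angular, angular, ← Complex.exp_nat_mul]
    congr 1
    push_cast; ring
  have e4 : star (rho z : ℂ) = rho z := Complex.conj_ofReal _
  rw [e1, discReflect_eq, e2, star_mul', star_angular, e4, mul_pow, mul_pow, e3, e3, pow_add,
    show (a : ℤ) - b = a * 1 + b * (-1) by ring, ← angular_mul]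
  ring

theorem eq_zero_of_inner_psi {f : Lp ℂ 2 omegaInfty}
    (h : ∀ (ν : ℤ) (s : Bool) (w : ℂ), besselD ν.natAbs s w = 0 →
      inner ℂ ((memLp_psi ν s w).toLp _) f = 0) : f = 0 := by
  have hf : Integrable (f : ℂ → ℂ) omegaInfty := (Lp.memLp f).integrable one_le_two
  have key : ∀ a b : ℕ,
      ∫ z in {z : ℂ | ‖z‖ ≤ 1}, discReflect z ^ a * star (discReflect z) ^ b * f z ∂omegaInfty = 0 ∧
      ∫ z in {z : ℂ | ‖z‖ ≤ 1}ᶜ, discReflect z ^ a * star (discReflect z) ^ b * f z ∂omegaInfty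
        = 0 := by
    intro a b
    -- The even and odd moments are the sum and the difference of the outer and inner integrals, so
    -- both integrals vanish.
    have hs : ∀ s : Bool,
        (if s then 1 else -1) * ∫ z in {z : ℂ | ‖z‖ ≤ 1},
          discReflect z ^ a * star (discReflect z) ^ b * f z ∂omegaInfty +
        ∫ z in {z : ℂ | ‖z‖ ≤ 1}ᶜ,
          discReflect z ^ a * star (discReflect z) ^ b * f z ∂omegaInfty = 0 := by
      intro s
      rw [← moments_eq_zero_of_inner_psi h (a - b) s (min a b), ← integral_add_compl
        measurableSet_disc (integrable_monomial_mul _ s _ hf), ← integral_const_mul]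
      congr 1
      · refine setIntegral_congr_fun measurableSet_disc fun z hz => ?_
        simp only [discReflect_pow_mul, monomial, sideSign, if_pos (show ‖z‖ ≤ 1 from hz)]
        ring
      · refine setIntegral_congr_fun measurableSet_disc.compl fun z hz => ?_
        simp only [discReflect_pow_mul, monomial, sideSign, if_neg (show ¬ ‖z‖ ≤ 1 from hz)]
        ring
    have h1 := hs true
    have h2 := hs false
    simp only [if_true, Bool.false_eq_true, if_false] at h1 h2
    constructor
    · linear_combination (h1 - h2) / 2
    · linear_combination (h1 + h2) / 2
  exact Lp.eq_zero_iff_ae_eq_zero.2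
    (ae_eq_zero_of_disc_moments hf (fun a b => (key a b).1) (fun a b => (key a b).2))

/-! ### The family `φ` -/

open scoped Classical in
/-- The parity under reflection in the unit circle of the eigenfunctions `φ_{ν,l}` with `l² = w`. -/
noncomputable def parity (ν : ℤ) (w : ℂ) : Bool := decide (besselB ν.natAbs w = 0)

theorem phi_eq (ν : ℤ) {l : ℂ} (hl : l ≠ 0) (z : ℂ) :
    phi ν l z = besselSign ν * (l / 2) ^ ν.natAbs * psi ν (parity ν (l ^ 2)) (l ^ 2) z := by
  have e : ∀ r : ℝ, besselJ ν (l * r) =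
      besselSign ν * (l / 2) ^ ν.natAbs * radial ν.natAbs (l ^ 2) r := fun r => by
    rw [besselJ_eq, radial, mul_pow l, div_pow, div_pow, mul_pow]; ring
  have e2 : besselJ ν (l / (‖z‖ : ℂ)) = besselJ ν (l * ((‖z‖⁻¹ : ℝ) : ℂ)) := by
    rw [div_eq_mul_inv, Complex.ofReal_inv]
  rw [phi, psi, e2, e, e, sideSign, rho, angular, parity]
  simp only [deriv_besselJ_eq_zero_iff ν hl]
  split_ifs <;> simp_all <;> ring

theorem besselD_parity {ν : ℤ} {l : ℂ} (h : l ∈ zeroSet 0 ν) :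
    besselD ν.natAbs (parity ν (l ^ 2)) (l ^ 2) = 0 := by
  rw [parity]
  by_cases hB : besselB ν.natAbs (l ^ 2) = 0
  · simp [besselD, hB]
  · simpa [besselD, hB] using (((mem_zeroSet_iff ν l).1 h).2.resolve_right hB)

/-- E_n and B_n have no common zero, so w determines the parity. -/
theorem parity_eq {ν : ℤ} {s : Bool} {w : ℂ} (h : besselD ν.natAbs s w = 0) : parity ν w = s := by
  cases s
  · simp [parity, besselB_ne_zero h]
  · simp [parity, show besselB ν.natAbs w = 0 from h]

theorem neg_mem_zeroSet {ν : ℤ} {l : ℂ} (h : l ∈ zeroSet 0 ν) : -l ∈ zeroSet 0 ν := by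
  rw [mem_zeroSet_iff] at h ⊢
  simpa using h

theorem phi_neg {ν : ℤ} {l : ℂ} (hl : l ≠ 0) (z : ℂ) : phi ν (-l) z = (-1) ^ ν * phi ν l z := by
  have e : ((-1 : ℂ)) ^ ν = (-1) ^ ν.natAbs := by
    rcases Int.natAbs_eq ν with h | h
    · conv_lhs => rw [h, zpow_natCast]
    · conv_lhs => rw [h, zpow_neg, zpow_natCast, ← inv_pow, inv_neg_one]
  rw [phi_eq ν (neg_ne_zero.2 hl), phi_eq ν hl, neg_sq, e, neg_div, neg_pow]
  ring

theorem one_eq_psi : (fun _ => 1 : ℂ → ℂ) = psi 0 true 0 := by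
  funext z
  simp [psi, sideSign, radial, besselE_zero_zero, angular]

/-- Every member of the family is a nonzero multiple of an eigenfunction `psi`. -/
theorem family_eq {S : ℤ → Set ℂ} (hS : ∀ ν, S ν ⊆ zeroSet 0 ν) (i : Option (Σ ν : ℤ, S ν)) :
    ∃ c : ℂ, c ≠ 0 ∧ ∃ ν : ℤ, ∃ s : Bool, ∃ w : ℂ, besselD ν.natAbs s w = 0 ∧
      family S i = c • psi ν s w ∧
      (∀ p, i = some p → ν = p.1 ∧ w = (p.2 : ℂ) ^ 2) ∧ (i = none → ν = 0 ∧ w = 0) := by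
  rcases i with _ | ⟨ν, l, hl⟩
  · refine ⟨1, one_ne_zero, 0, true, 0, (besselB_zero_iff 0).2 rfl, ?_, by simp, by simp⟩
    rw [one_smul, ← one_eq_psi]; rfl
  · have hl0 : l ≠ 0 := (hS ν hl).1
    refine ⟨besselSign ν * (l / 2) ^ ν.natAbs, mul_ne_zero (besselSign_ne_zero ν)
      (pow_ne_zero _ (div_ne_zero hl0 two_ne_zero)), ν, parity ν (l ^ 2), l ^ 2,
      besselD_parity (hS ν hl), funext fun z => phi_eq ν hl0 z, ?_, by simp⟩
    rintro p hp
    obtain rfl := Option.some_injective _ hp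
    exact ⟨rfl, rfl⟩

/-- For w ≠ 0, one of the two square roots of w lies in S. For w = 0 only B_0 vanishes, which
accounts for the constant function. -/
theorem exists_family_eq {S : ℤ → Set ℂ}
    (hS' : ∀ ν, ∀ l ∈ zeroSet 0 ν, Xor (l ∈ S ν) (-l ∈ S ν)) {ν : ℤ} {s : Bool} {w : ℂ}
    (h : besselD ν.natAbs s w = 0) :
    ∃ i : Option (Σ ν : ℤ, S ν), ∃ c : ℂ, psi ν s w = c • family S i := by
  by_cases hw : w = 0
  · subst hw
    cases s
    · exact absurd h (besselE_zero_ne _)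
    · obtain rfl : ν = 0 := Int.natAbs_eq_zero.1 ((besselB_zero_iff _).1 h)
      exact ⟨none, 1, by rw [one_smul, ← one_eq_psi]; rfl⟩
  · obtain ⟨l, hl⟩ : ∃ l : ℂ, l ^ 2 = w := by
      exact IsAlgClosed.exists_pow_nat_eq w two_pos
    have hl0 : l ≠ 0 := by rintro rfl; simp at hl; exact hw hl.symm
    have hmem : l ∈ zeroSet 0 ν := by
      rw [mem_zeroSet_iff, hl]
      refine ⟨hl0, ?_⟩
      cases s
      · exact Or.inl h
      · exact Or.inr h
    have aux : ∀ l' ∈ S ν, l' ^ 2 = w → l' ≠ 0 →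
        ∃ i : Option (Σ ν : ℤ, S ν), ∃ c : ℂ, psi ν s w = c • family S i := by
      intro l' hl' hsq hne
      refine ⟨some ⟨ν, l', hl'⟩, (besselSign ν * (l' / 2) ^ ν.natAbs)⁻¹, funext fun z => ?_⟩
      have hc : besselSign ν * (l' / 2) ^ ν.natAbs ≠ 0 := mul_ne_zero (besselSign_ne_zero ν)
        (pow_ne_zero _ (div_ne_zero hne two_ne_zero))
      change _ = _ * phi ν l' z
      rw [phi_eq ν hne, hsq, parity_eq h, inv_mul_cancel_left₀ hc]
    rcases hS' ν l hmem with h1 | h1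
    · exact aux l h1.1 hl hl0
    · exact aux (-l) h1.1 (by rw [neg_sq, hl]) (neg_ne_zero.2 hl0)

theorem family_index_injective {S : ℤ → Set ℂ} (hS : ∀ ν, S ν ⊆ zeroSet 0 ν)
    (hS' : ∀ ν, ∀ l ∈ zeroSet 0 ν, Xor (l ∈ S ν) (-l ∈ S ν)) {ν : ℤ} {l l' : ℂ}
    (hl : l ∈ S ν) (hl' : l' ∈ S ν) (h : l ^ 2 = l' ^ 2) : l = l' := by
  rcases sq_eq_sq_iff_eq_or_eq_neg.1 h with h | h
  · exact h
  · subst h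
    rcases hS' ν l' (hS ν hl') with h1 | h1
    · exact absurd hl h1.2
    · exact absurd hl' h1.2

theorem exists_hilbertBasis_family {S : ℤ → Set ℂ} (hS : ∀ ν, S ν ⊆ zeroSet 0 ν)
    (hS' : ∀ ν, ∀ l ∈ zeroSet 0 ν, Xor (l ∈ S ν) (-l ∈ S ν)) :
    ∃ hL : ∀ i, MemLp (family S i) 2 omegaInfty,
    ∃ b : HilbertBasis (Option (Σ ν : ℤ, S ν)) ℂ H0,
      ∀ i, ((b i : H0) : Lp ℂ 2 omegaInfty) =
        ((‖(hL i).toLp (family S i)‖⁻¹ : ℝ) : ℂ) • (hL i).toLp (family S i) := by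
  choose c hc ν s w hD hfam hsome hnone using family_eq hS
  have hL : ∀ i, MemLp (family S i) 2 omegaInfty := fun i => by
    rw [hfam]; exact (memLp_psi _ _ _).const_smul _
  have hLp : ∀ i, (hL i).toLp (family S i) = c i • (memLp_psi (ν i) (s i) (w i)).toLp _ := by
    intro i
    rw [← MemLp.toLp_const_smul]
    exact MemLp.toLp_congr _ _ (ae_of_all _ fun z => by rw [hfam])
  have hne : ∀ i, (hL i).toLp (family S i) ≠ 0 := fun i => by
    rw [hLp]; exact smul_ne_zero (hc i) (psi_toLp_ne_zero _ _ _)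
  have horth : ∀ i j, i ≠ j → inner ℂ ((hL i).toLp (family S i)) ((hL j).toLp (family S j)) = 0 := by
    intro i j hij
    rw [hLp, hLp, inner_smul_left, inner_smul_right,
      inner_psi_psi_eq_zero (hD i) (hD j), mul_zero, mul_zero]
    -- Equal ν and w force equal indices: w = 0 occurs only for the constant, and S contains just
    -- one square root of each other w.
    intro hν hw
    apply hij
    rcases i with _ | ⟨μ, l, hl⟩ <;> rcases j with _ | ⟨μ', l', hl'⟩
    · rfl
    · have h1 := (hnone none rfl).2
      have h2 := (hsome _ _ rfl : ν (some ⟨μ', l', hl'⟩) = μ' ∧ _).2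
      exact absurd (pow_eq_zero_iff two_ne_zero |>.1 (h2.symm.trans (hw.symm.trans h1)))
        (hS μ' hl').1
    · have h1 := (hnone none rfl).2
      have h2 := (hsome _ _ rfl : ν (some ⟨μ, l, hl⟩) = μ ∧ _).2
      exact absurd (pow_eq_zero_iff two_ne_zero |>.1 (h2.symm.trans (hw.trans h1)))
        (hS μ hl).1
    · obtain ⟨a1, a2⟩ := hsome (some ⟨μ, l, hl⟩) _ rfl
      obtain ⟨b1, b2⟩ := hsome (some ⟨μ', l', hl'⟩) _ rfl
      obtain rfl : μ = μ' := a1.symm.trans (hν.trans b1)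
      obtain rfl : l = l' := family_index_injective hS hS' hl hl' (a2.symm.trans (hw.trans b2))
      rfl
  have hmem : ∀ x : Lp ℂ 2 omegaInfty, x ∈ H0 := fun x => by rw [H0_eq_top]; trivial
  have : CompleteSpace H0 := (Submodule.isClosed_topologicalClosure _).completeSpace_coe
  let v : Option (Σ ν : ℤ, S ν) → H0 := fun i =>
    ⟨((‖(hL i).toLp (family S i)‖⁻¹ : ℝ) : ℂ) • (hL i).toLp (family S i), hmem _⟩
  have hv : Orthonormal ℂ v := by
    refine ⟨fun i => ?_, fun i j hij => ?_⟩
    · rw [Submodule.coe_norm, norm_smul, Complex.norm_real, norm_inv, norm_norm]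
      exact inv_mul_cancel₀ (norm_ne_zero_iff.2 (hne i))
    · change inner ℂ (v i) (v j) = 0
      rw [Submodule.coe_inner, inner_smul_left, inner_smul_right, horth i j hij, mul_zero, mul_zero]
  have hsp : (Submodule.span ℂ (Set.range v))ᗮ = ⊥ := by
    rw [Submodule.eq_bot_iff]
    intro f hf
    apply Subtype.ext
    refine eq_zero_of_inner_psi fun μ t u hu => ?_
    obtain ⟨i, d, hd⟩ := exists_family_eq hS' hu
    have h1 : (memLp_psi μ t u).toLp _ = d • (hL i).toLp (family S i) := by
      rw [← MemLp.toLp_const_smul]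
      exact MemLp.toLp_congr _ _ (ae_of_all _ fun z => by rw [hd])
    have h2 : inner ℂ (v i) f = 0 :=
      (Submodule.mem_orthogonal _ _).1 hf _ (Submodule.subset_span ⟨i, rfl⟩)
    rw [Submodule.coe_inner, inner_smul_left] at h2
    have h3 := (mul_eq_zero.1 h2).resolve_left 
      (star_ne_zero.2 (Complex.ofReal_ne_zero.2 (inv_ne_zero (norm_ne_zero_iff.2 (hne i)))))
    rw [h1, inner_smul_left, h3, mul_zero]
  refine ⟨hL, HilbertBasis.mkOfOrthogonalEqBot hv hsp, fun i => ?_⟩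
  rw [HilbertBasis.coe_mkOfOrthogonalEqBot]

end CanonicalLaplacian

theorem mainTheorem7 :
    (∀ (ν : ℤ), ∀ l ∈ CanonicalLaplacian.zeroSet 0 ν,
      -l ∈ CanonicalLaplacian.zeroSet 0 ν ∧
      ∀ z : ℂ, CanonicalLaplacian.phi ν (-l) z = (-1) ^ ν * CanonicalLaplacian.phi ν l z) ∧
    ∀ S : ℤ → Set ℂ,
      (∀ ν, S ν ⊆ CanonicalLaplacian.zeroSet 0 ν) →
      (∀ ν, ∀ l ∈ CanonicalLaplacian.zeroSet 0 ν, Xor (l ∈ S ν) (-l ∈ S ν)) →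
      ∃ hL : ∀ i, MemLp (CanonicalLaplacian.family S i) 2 CanonicalLaplacian.omegaInfty,
      ∃ b : HilbertBasis (Option (Σ ν : ℤ, S ν)) ℂ CanonicalLaplacian.H0,
        ∀ i, ((b i : CanonicalLaplacian.H0) : Lp ℂ 2 CanonicalLaplacian.omegaInfty) =
          ((‖(hL i).toLp (CanonicalLaplacian.family S i)‖⁻¹ : ℝ) : ℂ) •
            (hL i).toLp (CanonicalLaplacian.family S i) := by
  exact ⟨fun ν l hl => ⟨CanonicalLaplacian.neg_mem_zeroSet hl,
    fun z => CanonicalLaplacian.phi_neg hl.1 z⟩,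
    fun S hS hS' => CanonicalLaplacian.exists_hilbertBasis_family hS hS'⟩
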